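/- Let $\gamma>2$ and let $\mathscr D$ be a non-negative integer-valued random variable with density $f(k)=\mathbb P(\mathscr D=k)$ that is regularly varying with exponent $\gamma$: $f(k)=l(k)\,k^{-\gamma-1}$ for $k=1,2,\dots$, where $l$ is slowly varying at infinity (eventually positive, with $l(cx)/l(x)\to 1$ as $x\to\infty$ for every $c>0$) and eventually monotone. Put $\nu_1=\mathbb E[\mathscr D]$, $\nu_2=\mathbb E[\mathscr D^2]$ and $f^*(k)=k f(k)/\nu_1$. For each $n$ let $\widehat G_n$ be the erased configuration model on $n$ nodes with i.i.d. degrees: take $n$ independent samples of $\mathscr D$, add $1$ to the last one if their sum is odd, attach to each node as many half-edges as its resulting value, pair all half-edges uniformly at random, and then remove all self-loops and replace multiple edges by single edges. Let $\widehat G_{ij}\in\{0,1\}$ be the number of edges from $i$ to $j$ in $\widehat G_n$, $\widehat D_i=\sum_j\widehat G_{ij}$ the degrees, $\widehat L_n=\sum_i\widehat D_i$, and $$\widehat f_n(k)=\frac1n\sum_i 1_{\{\widehat D_i=k\}},\qquad \widehat f_n^*(k)=\frac1{\widehat L_n}\sum_{i,j}\widehat G_{ij}1_{\{\widehat D_i=k\}},\qquad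 \widehat h_n(k,\ell)=\frac1{\widehat L_n}\sum_{i,j}\widehat G_{ij}1_{\{\widehat D_i=k,\ \widehat D_j=\ell\}}.$$ The average nearest neighbor degree is $$\widehat\Phi_n(k)=1_{\{\widehat f_n(k)>0\}}\,\frac{\sum_{\ell>0}\widehat h_n(k,\ell)\,\ell}{\widehat f_n^*(k)}.$$ Then for every $k$ with $f^*(k)>0$ and every $\delta$ with $$0<\delta<\frac{\gamma-1}{2(\gamma+3)}\qquad\text{and}\qquad \delta<1-\frac2\gamma,$$ we have $$\lim_{n\to\infty}\mathbb P\Big(\Big|\widehat\Phi_n(k)-\frac{\nu_2}{\nu_1}\Big|>n^{-\delta}\Big)=0 .$$ -/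

import Mathlib

open Filter Topology MeasureTheory
open scoped ENNReal

noncomputable section

namespace ECM

/-! ### Regularly varying distributions -/

/-- `l` is slowly varying (at infinity). -/
def SlowlyVarying (l : ℝ → ℝ) : Prop :=
  (∀ᶠ x in atTop, 0 < l x) ∧
    ∀ c : ℝ, 0 < c → Tendsto (fun x => l (c * x) / l x) atTop (𝓝 1)

/-- `l` is monotone (nondecreasing or nonincreasing) on some half-line. -/
def EventuallyMonotone (l : ℝ → ℝ) : Prop :=
  ∃ x₀ : ℝ, MonotoneOn l (Set.Ici x₀) ∨ AntitoneOn l (Set.Ici x₀)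

/-- The probability density (mass) function of the degree law `p`. -/
def density (p : PMF ℕ) (k : ℕ) : ℝ := (p k).toReal

/-- The law `p` is regularly varying with exponent `γ`:
`P(D = k) = l(k) k ^ (-γ - 1)` for `k = 1, 2, …`, where `l` is slowly varying and eventually
monotone. -/
def RegularlyVarying (p : PMF ℕ) (γ : ℝ) : Prop :=
  ∃ l : ℝ → ℝ, SlowlyVarying l ∧ EventuallyMonotone l ∧
    ∀ k : ℕ, 1 ≤ k → density p k = l k * (k : ℝ) ^ (-γ - 1)

/-- The moment `ν_r = E[D ^ r]` of the degree law. -/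
def nu (p : PMF ℕ) (r : ℕ) : ℝ := ∫ k : ℕ, (k : ℝ) ^ r ∂p.toMeasure

/-- The size-biased density `f*(k) = k f(k) / E[D]`. -/
def sizeBiased (p : PMF ℕ) (k : ℕ) : ℝ := (k : ℝ) * density p k / nu p 1

/-! ### The average nearest neighbor degree of a multigraph

A multigraph on `Fin n` is given by the matrix `G`, where `G i j` is the number of directed edges
`i → j` (each undirected edge gives two directed ones, so `G i i` is twice the number of
self-loops at `i`). -/

section Multigraph

variable {n : ℕ}

/-- The degree `D_i`. -/
def degree (G : Matrix (Fin n) (Fin n) ℕ) (i : Fin n) : ℕ := ∑ j, G i j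

/-- The sum `L_n` of all degrees. -/
def totalDegree (G : Matrix (Fin n) (Fin n) ℕ) : ℕ := ∑ i, degree G i

/-- The empirical degree density `f_n(k)`. -/
def empDensity (G : Matrix (Fin n) (Fin n) ℕ) (k : ℕ) : ℝ :=
  (1 / (n : ℝ)) * ∑ i, if degree G i = k then (1 : ℝ) else 0

/-- The size-biased empirical degree density `f_n*(k)`: the fraction of the directed edges
`i → j` with `D_i = k`. -/
def empSizeBiased (G : Matrix (Fin n) (Fin n) ℕ) (k : ℕ) : ℝ :=
  (1 / (totalDegree G : ℝ)) *
    ∑ i, ∑ j, if degree G i = k then (G i j : ℝ) else 0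

/-- The joint degree distribution `h_n(k, ℓ)`: the fraction of the directed edges `i → j` with
`D_i = k` and `D_j = ℓ`. -/
def jointDensity (G : Matrix (Fin n) (Fin n) ℕ) (k l : ℕ) : ℝ :=
  (1 / (totalDegree G : ℝ)) *
    ∑ i, ∑ j, if degree G i = k ∧ degree G j = l then (G i j : ℝ) else 0

open Classical in
/-- The average nearest neighbor degree `Φ_n(k)`. The sum over `l` has finitely many nonzero
terms. -/
def annd (G : Matrix (Fin n) (Fin n) ℕ) (k : ℕ) : ℝ :=
  if 0 < empDensity G k then
    (∑' l : ℕ, jointDensity G k l * (l : ℝ)) / empSizeBiased G k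
  else 0

/-- Erasure: self-loops are removed and multiple edges are replaced by a single edge. -/
def erase (G : Matrix (Fin n) (Fin n) ℕ) : Matrix (Fin n) (Fin n) ℕ :=
  Matrix.of fun i j => if i ≠ j ∧ 0 < G i j then 1 else 0

end Multigraph

/-! ### The configuration model -/

section Configuration

variable {n : ℕ}

/-- The degree sequence obtained from a sample `x` by adding `1` to its last entry if the sum of
the entries is odd. -/
def parityCorrect (x : Fin n → ℕ) (i : Fin n) : ℕ :=
  x i + if (i : ℕ) + 1 = n ∧ Odd (∑ j, x j) then 1 else 0

/-- The stubs (half-edges): node `i` has `d i` of them. -/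
abbrev Stub (d : Fin n → ℕ) : Type := Σ i : Fin n, Fin (d i)

/-- The pairings of the stubs (perfect matchings): a pairing maps each stub to its partner. -/
abbrev Pairing (d : Fin n → ℕ) : Type :=
  {m : Stub d → Stub d // Function.Involutive m ∧ ∀ s, m s ≠ s}

instance instFintypePairing (d : Fin n → ℕ) : Fintype (Pairing d) := Fintype.ofFinite _

/-- The multigraph of a pairing: `G i j` is the number of stubs of `i` whose partner is at `j`. -/
def pairingGraph (d : Fin n → ℕ) (m : Pairing d) : Matrix (Fin n) (Fin n) ℕ :=
  Matrix.of fun i j => (Finset.univ.filter fun s : Stub d => s.1 = i ∧ (m.1 s).1 = j).card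

theorem even_sum_parityCorrect (x : Fin n → ℕ) : Even (∑ i, parityCorrect x i) := by
  cases n with
  | zero => simp
  | succ n =>
    have h : ∑ i, parityCorrect x i = (∑ j, x j) + if Odd (∑ j, x j) then 1 else 0 := by
      simp only [parityCorrect, Finset.sum_add_distrib]
      congr 1
      rw [Finset.sum_eq_single (Fin.last n)]
      · simp
      · intro b _ hb
        rw [if_neg]
        rintro ⟨h1, -⟩
        exact hb (Fin.ext (by simpa using h1))
      · simp
    rw [h]
    split_ifs with ho
    · exact ho.add_one
    · simpa using ho

theorem nonempty_pairing (d : Fin n → ℕ) (hd : Even (∑ i, d i)) : Nonempty (Pairing d) := by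
  obtain ⟨m, hm⟩ := hd
  have hc : Fintype.card (Stub d) = Fintype.card (Fin m ⊕ Fin m) := by
    simp [hm]
  let e : Stub d ≃ Fin m ⊕ Fin m := Fintype.equivOfCardEq hc
  refine ⟨⟨fun s => e.symm (Sum.swap (e s)), ?_, ?_⟩⟩
  · intro s
    simp
  · intro s hs
    have h : Sum.swap (e s) = e s := by
      have := congrArg e hs
      simpa using this
    rcases h1 : e s with a | a <;> simp [h1] at h

instance instNonemptyPairing (x : Fin n → ℕ) : Nonempty (Pairing (parityCorrect x)) :=
  nonempty_pairing _ (even_sum_parityCorrect x)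

end Configuration

/-- The law of `n` independent samples from `p`. -/
def iidLaw (p : PMF ℕ) (n : ℕ) : PMF (Fin n → ℕ) :=
  (Measure.pi fun _ : Fin n => p.toMeasure).toPMF

/-- The law of the configuration model multigraph with degree sequence `IID(p)`: sample the
degrees, correct the parity, and pair the stubs uniformly at random. -/
def configurationModel (p : PMF ℕ) (n : ℕ) : PMF (Matrix (Fin n) (Fin n) ℕ) :=
  (iidLaw p n).bind fun x =>
    (PMF.uniformOfFintype (Pairing (parityCorrect x))).map (pairingGraph (parityCorrect x))

/-- The law of the erased configuration model with degree sequence `IID(p)`. -/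
def erasedConfigurationModel (p : PMF ℕ) (n : ℕ) : PMF (Matrix (Fin n) (Fin n) ℕ) :=
  (configurationModel p n).map erase

end ECM

end

/-! Fix the parity-corrected degrees `d`, with `L = ∑ d`, `Q = ∑ d ^ 2` and maximum at most `B`.
Before erasure the average nearest neighbor degree at `k` is a sum, over the stubs at nodes of
degree `k`, of the degree of the node holding the partner stub, divided by the number of those
stubs. In a uniform pairing a partner is almost a uniform stub, whose node has mean degree `Q / L`.
Partners of different stubs are nearly uncorrelated, so the sum has mean square error `O(Q * B)`
about `Q / L` times the number of stubs (`matchMean_nbrSum_sub_sq_le`), and Chebyshev applies.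
Erasure removes on average at most `8 * (Q / L) ^ 2` directed edges (`matchMean_lostEdges_le`), and
each one moves numerator and denominator by a controlled amount (`abs_annd_sub_le`), so Markov
applies. `card_bad_le` combines the two.

For the random degrees, all moments of order `s < γ` are finite. With `a` slightly above `1 / γ`,
all degrees are below `n ^ a` with high probability. Truncating at `n ^ a` then gives concentration
of the empirical second moment even when the fourth moment is infinite, and `Q / L` is within `o(n ^
(-δ))` of `ν₂ / ν₁` (`tendsto_pi_typicalSamples_compl`). On typical samples the conditional failure
probability is `O(n ^ (a + 2 * δ - 1))`. The conditions on `δ` allow all these exponents to be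
chosen consistently (`exists_exponents`). -/

noncomputable section
namespace ECM

/-! ### Uniform perfect matchings: one- and two-point probabilities -/

section Matchings

variable {α : Type*} [Fintype α] [DecidableEq α]

/-- The perfect matchings of a finite type. -/
abbrev Matching (α : Type*) : Type _ := {m : α → α // Function.Involutive m ∧ ∀ s, m s ≠ s}

instance instFintypeMatching : Fintype (Matching α) := Fintype.ofFinite _

/-- Relabelling a matching by a permutation. -/
def Matching.conj (σ : Equiv.Perm α) : Matching α ≃ Matching α where
  toFun m := ⟨fun s => σ (m.1 (σ.symm s)), fun s => by simp [m.2.1 _], fun s h =>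
    m.2.2 (σ.symm s) ((Equiv.eq_symm_apply σ).2 h)⟩
  invFun m := ⟨fun s => σ.symm (m.1 (σ s)), fun s => by simp [m.2.1 _], fun s h =>
    m.2.2 (σ s) ((Equiv.symm_apply_eq σ).1 h)⟩
  left_inv m := by ext s; simp
  right_inv m := by ext s; simp

/-- The number of matchings with a given pair. -/
def matchCount (s t : α) : ℕ := Fintype.card {m : Matching α // m.1 s = t}

/-- The number of matchings with two given pairs. -/
def matchCount₂ (s t s' t' : α) : ℕ := Fintype.card {m : Matching α // m.1 s = t ∧ m.1 s' = t'}

theorem matchCount_conj (σ : Equiv.Perm α) (s t : α) :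
    matchCount (σ s) (σ t) = matchCount s t := by
  unfold matchCount
  refine (Fintype.card_congr ((Matching.conj σ).subtypeEquiv fun m => ?_)).symm
  simp [Matching.conj]

theorem matchCount₂_conj (σ : Equiv.Perm α) (s t s' t' : α) :
    matchCount₂ (σ s) (σ t) (σ s') (σ t') = matchCount₂ s t s' t' := by
  unfold matchCount₂
  refine (Fintype.card_congr ((Matching.conj σ).subtypeEquiv fun m => ?_)).symm
  simp [Matching.conj]

theorem matchCount_self (s : α) : matchCount s s = 0 := by
  unfold matchCount
  rw [Fintype.card_eq_zero_iff]
  exact ⟨fun m => m.1.2.2 s m.2⟩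

theorem sum_matching_eq (s : α) (F : α → ℝ) :
    ∑ m : Matching α, F (m.1 s) = ∑ t, (matchCount s t : ℝ) * F t := by
  rw [← Finset.sum_fiberwise (s := Finset.univ) (g := fun m : Matching α => m.1 s)]
  refine Finset.sum_congr rfl fun t _ => ?_
  rw [Finset.sum_congr rfl (g := fun _ => F t) (by simp +contextual)]
  simp [matchCount, Fintype.card_subtype]

theorem sum_matching₂_eq (s s' : α) (F : α → α → ℝ) :
    ∑ m : Matching α, F (m.1 s) (m.1 s') =
      ∑ t, ∑ t', (matchCount₂ s t s' t' : ℝ) * F t t' := by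
  rw [← Finset.sum_fiberwise (s := Finset.univ)
    (g := fun m : Matching α => ((m.1 s, m.1 s') : α × α)), Fintype.sum_prod_type]
  refine Finset.sum_congr rfl fun t _ => Finset.sum_congr rfl fun t' _ => ?_
  rw [Finset.sum_congr rfl (g := fun _ => F t t')
    (by simp only [Finset.mem_filter, Prod.mk.injEq]; rintro m ⟨-, h1, h2⟩; rw [h1, h2])]
  simp [matchCount₂, Fintype.card_subtype]

/-- Relabelling symmetry makes the `L - 1` possible partners of `s` equally frequent, and the
corresponding classes partition all matchings. -/
theorem card_mul_matchCount {s t : α} (h : t ≠ s) :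
    ((Fintype.card α : ℝ) - 1) * matchCount s t = Fintype.card (Matching α) := by
  have h1 := sum_matching_eq s (fun _ => (1 : ℝ))
  have h2 : ∀ u ∈ Finset.univ.erase s, (matchCount s u : ℝ) * 1 = matchCount s t := by
    intro u hu
    have hu : u ≠ s := by simpa using hu
    have := matchCount_conj (Equiv.swap t u) s t
    rw [Equiv.swap_apply_of_ne_of_ne h.symm hu.symm, Equiv.swap_apply_left] at this
    simp [this]
  rw [← Finset.add_sum_erase _ _ (Finset.mem_univ s), matchCount_self,
    Finset.sum_congr rfl h2] at h1
  simp only [Finset.sum_const, Finset.card_erase_of_mem (Finset.mem_univ s), Finset.card_univ,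
    nsmul_eq_mul, mul_one] at h1
  rw [Nat.cast_sub (Fintype.card_pos_iff.2 ⟨s⟩)] at h1
  simp at h1
  linarith

theorem matchCount₂_eq_zero_of_eq {s t s' : α} (hs : s ≠ s') : matchCount₂ s t s' t = 0 := by
  unfold matchCount₂
  rw [Fintype.card_eq_zero_iff]
  exact ⟨fun m => hs (m.1.2.1.injective (m.2.1.trans m.2.2.symm))⟩

theorem matchCount₂_eq_zero_left {s s' t' : α} : matchCount₂ s s s' t' = 0 := by
  unfold matchCount₂
  rw [Fintype.card_eq_zero_iff]
  exact ⟨fun m => m.1.2.2 s m.2.1⟩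

theorem matchCount₂_eq_zero_right {s t s' : α} : matchCount₂ s t s' s' = 0 := by
  unfold matchCount₂
  rw [Fintype.card_eq_zero_iff]
  exact ⟨fun m => m.1.2.2 s' m.2.2⟩

theorem matchCount₂_eq_zero_cross {s t s' : α} (h : t ≠ s') : matchCount₂ s t s' s = 0 := by
  unfold matchCount₂
  rw [Fintype.card_eq_zero_iff]
  refine ⟨fun ⟨m, h1, h2⟩ => h ?_⟩
  have := m.2.1 s'
  rw [h2] at this
  exact h1.symm.trans this

theorem matchCount₂_eq_zero_cross' {s t' s' : α} (h : t' ≠ s) : matchCount₂ s s' s' t' = 0 := by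
  unfold matchCount₂
  rw [Fintype.card_eq_zero_iff]
  refine ⟨fun ⟨m, h1, h2⟩ => h ?_⟩
  have := m.2.1 s
  rw [h1] at this
  exact h2.symm.trans this

theorem matchCount₂_cross {s s' : α} : matchCount₂ s s' s' s = matchCount s s' := by
  unfold matchCount₂ matchCount
  refine Fintype.card_congr (Equiv.subtypeEquivRight fun m => ⟨fun h => h.1, fun h => ⟨h, ?_⟩⟩)
  rw [← h, m.2.1]

theorem sum_matchCount₂ (s t s' : α) : ∑ t', (matchCount₂ s t s' t' : ℝ) = matchCount s t := by
  have h1 := sum_matching₂_eq s s' (fun u _ => if u = t then (1 : ℝ) else 0)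
  have h2 := sum_matching_eq s (fun u => if u = t then (1 : ℝ) else 0)
  rw [h2, Finset.sum_comm] at h1
  simpa using h1.symm

/-- Once `s` is matched to `t`, transpositions fixing `s`, `t`, `s'` show that the remaining `L - 3`
candidates are equally likely partners of `s'`. -/
theorem card_mul_matchCount₂ {s t s' t' : α} (hs : s ≠ s') (ht : t ≠ s) (ht' : t ≠ s')
    (h1 : t' ≠ s) (h2 : t' ≠ s') (h3 : t' ≠ t) :
    ((Fintype.card α : ℝ) - 3) * matchCount₂ s t s' t' = matchCount s t := by
  have h4 : ∀ u, (matchCount₂ s t s' u : ℝ) =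
      if u ∈ ({s, s', t} : Finset α)ᶜ then (matchCount₂ s t s' t' : ℝ) else 0 := by
    intro u
    split_ifs with hu
    · simp only [Finset.mem_compl, Finset.mem_insert, Finset.mem_singleton, not_or] at hu
      have := matchCount₂_conj (Equiv.swap t' u) s t s' t'
      rw [Equiv.swap_apply_of_ne_of_ne h1.symm (Ne.symm hu.1), Equiv.swap_apply_left,
        Equiv.swap_apply_of_ne_of_ne h2.symm (Ne.symm hu.2.1),
        Equiv.swap_apply_of_ne_of_ne h3.symm (Ne.symm hu.2.2)] at this
      simp [this]
    · simp only [Finset.mem_compl, Finset.mem_insert, Finset.mem_singleton, not_not] at hu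
      rcases hu with rfl | rfl | rfl
      · simp [matchCount₂_eq_zero_cross ht']
      · simp [matchCount₂_eq_zero_right]
      · simp [matchCount₂_eq_zero_of_eq hs]
  rw [← sum_matchCount₂ s t s', Finset.sum_congr rfl fun u _ => h4 u, ← Finset.sum_filter]
  have hc : ({s, s', t} : Finset α).card = 3 := by
    rw [Finset.card_eq_three]; exact ⟨s, s', t, hs, ht.symm, ht'.symm, rfl⟩
  have hc' : 3 ≤ Fintype.card α := by rw [← hc]; exact Finset.card_le_univ _
  simp only [Finset.filter_univ_mem, Finset.sum_const, Finset.card_compl, hc, nsmul_eq_mul]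
  rw [Nat.cast_sub hc']
  norm_num

/-- The mean of a real function over all perfect matchings. -/
def matchMean (X : Matching α → ℝ) : ℝ := (∑ m, X m) / Fintype.card (Matching α)

variable [Nonempty (Matching α)]

theorem matchMean_apply (hL : 1 < (Fintype.card α : ℝ)) (s : α) (F : α → ℝ) :
    matchMean (fun m => F (m.1 s)) = (∑ t, F t - F s) / (Fintype.card α - 1) := by
  have hP : (Fintype.card (Matching α) : ℝ) ≠ 0 := by
    have : 0 < Fintype.card (Matching α) := Fintype.card_pos
    positivity
  have hL' : (Fintype.card α : ℝ) - 1 ≠ 0 := by linarith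
  have h : ∀ t ∈ Finset.univ.erase s, (matchCount s t : ℝ) * F t =
      Fintype.card (Matching α) / (Fintype.card α - 1) * F t := by
    intro t ht
    rw [← card_mul_matchCount (Finset.ne_of_mem_erase ht)]
    field_simp
  rw [matchMean, sum_matching_eq, ← Finset.add_sum_erase _ _ (Finset.mem_univ s),
    matchCount_self, Finset.sum_congr rfl h, ← Finset.mul_sum,
    ← Finset.add_sum_erase _ F (Finset.mem_univ s)]
  field_simp
  simp

/-- Either `s` and `s'` are matched together, with probability `1 / (L - 1)`, or their partners form
a given admissible pair with probability `1 / ((L - 1) * (L - 3))`. Nonnegativity of `F` allows the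
second sum to run over all pairs. -/
theorem matchMean_apply₂_le (hL : 3 < (Fintype.card α : ℝ)) {s s' : α} (hs : s ≠ s')
    (F : α → α → ℝ) (hF : ∀ t t', 0 ≤ F t t') :
    matchMean (fun m => F (m.1 s) (m.1 s')) ≤
      F s' s / (Fintype.card α - 1) +
        (∑ t, ∑ t', F t t') / ((Fintype.card α - 1) * (Fintype.card α - 3)) := by
  have hP : 0 < (Fintype.card (Matching α) : ℝ) := by
    have : 0 < Fintype.card (Matching α) := Fintype.card_pos
    positivity
  set L : ℝ := (Fintype.card α : ℝ) with hLdef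
  have h1 : (0 : ℝ) < L - 1 := by linarith
  have h3 : (0 : ℝ) < L - 3 := by linarith
  set P : ℝ := (Fintype.card (Matching α) : ℝ) with hPdef
  have key : ∀ t t', (matchCount₂ s t s' t' : ℝ) * F t t' ≤
      (if t = s' then if t' = s then P / (L - 1) * F s' s else 0 else 0) +
        P / ((L - 1) * (L - 3)) * F t t' := by
    intro t t'
    have hnn : 0 ≤ P / ((L - 1) * (L - 3)) * F t t' :=
      mul_nonneg (by positivity) (hF _ _)
    have hnn' : 0 ≤ P / (L - 1) * F s' s := mul_nonneg (by positivity) (hF _ _)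
    have hz : (matchCount₂ s t s' t' : ℝ) = 0 → (matchCount₂ s t s' t' : ℝ) * F t t' ≤
      (if t = s' then if t' = s then P / (L - 1) * F s' s else 0 else 0) +
        P / ((L - 1) * (L - 3)) * F t t' := by
      intro h0
      rw [h0, zero_mul]
      split_ifs <;> linarith
    by_cases a : t = s'
    · by_cases b : t' = s
      · subst a; subst b
        have := card_mul_matchCount (s := t') (t := t) hs.symm
        rw [← hLdef, ← hPdef] at this
        rw [matchCount₂_cross, if_pos rfl, if_pos rfl, ← this]
        have e : (L - 1) * (matchCount t' t : ℝ) / (L - 1) = matchCount t' t := by field_simp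
        rw [this] at e ⊢
        rw [e]
        linarith
      · subst a
        exact hz (by simp [matchCount₂_eq_zero_cross' b])
    · by_cases b : t = s
      · subst b; exact hz (by simp [matchCount₂_eq_zero_left])
      by_cases c : t' = s
      · subst c; exact hz (by simp [matchCount₂_eq_zero_cross a])
      by_cases d : t' = s'
      · subst d; exact hz (by simp [matchCount₂_eq_zero_right])
      by_cases e : t' = t
      · subst e; exact hz (by simp [matchCount₂_eq_zero_of_eq hs])
      rw [if_neg a, zero_add]
      have q1 := card_mul_matchCount₂ hs b a c d e
      have q2 := card_mul_matchCount b
      rw [← q1, ← hLdef, ← hPdef] at q2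
      rw [← q2]
      apply le_of_eq
      field_simp
  rw [matchMean, sum_matching₂_eq, div_le_iff₀ hP]
  refine (Finset.sum_le_sum fun t _ => Finset.sum_le_sum fun t' _ => key t t').trans
    (le_of_eq ?_)
  simp only [Finset.sum_add_distrib, ← Finset.mul_sum]
  simp
  field_simp

end Matchings

/-! ### Deterministic effect of deleting edges -/

section Deterministic

variable {n : ℕ}

/-- The sum over the nodes of degree `k` of the degrees of their neighbours. -/
def nbrSum (G : Matrix (Fin n) (Fin n) ℕ) (k : ℕ) : ℝ :=
  ∑ i, if degree G i = k then ∑ j, (G i j : ℝ) * degree G j else 0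

/-- The number of nodes of degree `k`. -/
def nodeCount (d : Fin n → ℕ) (k : ℕ) : ℝ := ∑ i, if d i = k then (1 : ℝ) else 0

theorem hasSum_jointDensity (G : Matrix (Fin n) (Fin n) ℕ) (k : ℕ) :
    HasSum (fun l : ℕ => jointDensity G k l * (l : ℝ)) (1 / (totalDegree G : ℝ) * nbrSum G k) := by
  have h : ∀ i j, HasSum
      (fun l : ℕ => (if degree G i = k ∧ degree G j = l then (G i j : ℝ) else 0) * (l : ℝ))
      (if degree G i = k then (G i j : ℝ) * degree G j else 0) := by
    intro i j
    by_cases hi : degree G i = k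
    · have := hasSum_ite_eq (degree G j) ((G i j : ℝ) * degree G j)
      convert this using 1
      · ext l
        by_cases hl : l = degree G j
        · simp [hi, hl]
        · simp [hi, hl, Ne.symm hl]
      · simp [hi]
    · simp [hi, hasSum_zero]
  have h2 := (hasSum_sum fun i (_ : i ∈ Finset.univ) =>
    hasSum_sum fun j (_ : j ∈ Finset.univ) => h i j).mul_left (1 / (totalDegree G : ℝ))
  convert h2 using 1
  · rfl
  · ext l
    simp only [jointDensity, Finset.sum_mul, mul_assoc]
  · unfold nbrSum
    congr 1
    refine Finset.sum_congr rfl fun i _ => ?_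
    split_ifs <;> simp

/-- The factor `1 / L` cancels between numerator and denominator; a node of degree `k ≥ 1` ensures
`L > 0`. -/
theorem annd_eq (G : Matrix (Fin n) (Fin n) ℕ) {k : ℕ} (hk : 1 ≤ k)
    (h : 0 < nodeCount (degree G) k) :
    annd G k = nbrSum G k / (k * nodeCount (degree G) k) := by
  have hi : ∃ i, degree G i = k := by
    by_contra! hc
    simp [nodeCount, hc] at h
  obtain ⟨i, hi⟩ := hi
  have hn : 0 < n := i.pos
  have hL : 0 < (totalDegree G : ℝ) := by
    have : degree G i ≤ totalDegree G := Finset.single_le_sum (f := degree G)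
      (fun _ _ => Nat.zero_le _) (Finset.mem_univ i)
    exact_mod_cast lt_of_lt_of_le (by omega) this
  have he : 0 < empDensity G k := by
    unfold empDensity
    change 0 < 1 / (n : ℝ) * nodeCount (degree G) k
    positivity
  have hs : empSizeBiased G k = 1 / (totalDegree G : ℝ) * (k * nodeCount (degree G) k) := by
    unfold empSizeBiased nodeCount
    congr 1
    rw [Finset.mul_sum]
    refine Finset.sum_congr rfl fun i _ => ?_
    split_ifs with hi
    · rw [← hi, degree]; push_cast; simp
    · simp
  unfold annd
  rw [if_pos he, (hasSum_jointDensity G k).tsum_eq, hs]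
  field_simp

/-- The number of directed edges lost when passing from `G` to `H`. -/
def lostEdges (G H : Matrix (Fin n) (Fin n) ℕ) : ℝ := ∑ i, ((degree G i : ℝ) - degree H i)

/-- A row that lost an edge is charged its maximal value `k * B` against that loss. An intact row
changes only through the degrees of its neighbors; summing over columns, by symmetry, this costs at
most `B` per lost edge. -/
theorem abs_nbrSum_sub_le {G H : Matrix (Fin n) (Fin n) ℕ} (hle : ∀ i j, H i j ≤ G i j)
    (hsymm : ∀ i j, G i j = G j i) (k : ℕ) {B : ℝ} (hB : ∀ i, (degree G i : ℝ) ≤ B) (hB0 : 0 ≤ B) :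
    |nbrSum H k - nbrSum G k| ≤ (k + 1) * B * lostEdges G H := by
  have hd : ∀ i, degree H i ≤ degree G i := fun i => Finset.sum_le_sum fun j _ => hle i j
  have hd' : ∀ i, (degree H i : ℝ) ≤ degree G i := fun i => by exact_mod_cast hd i
  have hHB : ∀ i, (degree H i : ℝ) ≤ B := fun i => (hd' i).trans (hB i)
  have hrow : ∀ (K : Matrix (Fin n) (Fin n) ℕ), (∀ i, (degree K i : ℝ) ≤ B) → ∀ i,
      0 ≤ (if degree K i = k then ∑ j, (K i j : ℝ) * degree K j else 0) ∧
      (if degree K i = k then ∑ j, (K i j : ℝ) * degree K j else 0) ≤ k * B := by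
    intro K hK i
    split_ifs with h
    · refine ⟨Finset.sum_nonneg fun j _ => by positivity, ?_⟩
      calc ∑ j, (K i j : ℝ) * degree K j ≤ ∑ j, (K i j : ℝ) * B :=
            Finset.sum_le_sum fun j _ => mul_le_mul_of_nonneg_left (hK j) (by positivity)
        _ = k * B := by rw [← Finset.sum_mul, ← h, degree]; push_cast; rfl
    · exact ⟨le_rfl, by positivity⟩
  have key : ∀ i, |(if degree H i = k then ∑ j, (H i j : ℝ) * degree H j else 0) -
      (if degree G i = k then ∑ j, (G i j : ℝ) * degree G j else 0)| ≤
      k * B * ((degree G i : ℝ) - degree H i) +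
        ∑ j, (G i j : ℝ) * ((degree G j : ℝ) - degree H j) := by
    intro i
    have hnn : 0 ≤ ∑ j, (G i j : ℝ) * ((degree G j : ℝ) - degree H j) :=
      Finset.sum_nonneg fun j _ => mul_nonneg (by positivity) (sub_nonneg.2 (hd' j))
    rcases (hd i).eq_or_lt with h | h
    · have hrow_eq : ∀ j, H i j = G i j := by
        intro j
        exact (Finset.sum_eq_sum_iff_of_le (fun j _ => hle i j)).1 h j (Finset.mem_univ _)
      rw [h, sub_self, mul_zero, zero_add]
      split_ifs with hk
      · rw [abs_sub_comm, ← Finset.sum_sub_distrib, abs_of_nonneg]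
        · exact (Finset.sum_congr rfl fun j _ => by rw [hrow_eq j, mul_sub]).le
        · exact Finset.sum_nonneg fun j _ => by
            rw [hrow_eq j, ← mul_sub]
            exact mul_nonneg (by positivity) (sub_nonneg.2 (hd' j))
      · simpa using hnn
    · have h1 : (1 : ℝ) ≤ (degree G i : ℝ) - degree H i := by
        rw [le_sub_iff_add_le]; exact_mod_cast (by omega)
      have h2 : |(if degree H i = k then ∑ j, (H i j : ℝ) * degree H j else 0) -
          (if degree G i = k then ∑ j, (G i j : ℝ) * degree G j else 0)| ≤ k * B := by
        have a := hrow H hHB i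
        have b := hrow G hB i
        rw [abs_le]; constructor <;> linarith [a.1, a.2, b.1, b.2]
      have h3 : (k : ℝ) * B * 1 ≤ k * B * ((degree G i : ℝ) - degree H i) :=
        mul_le_mul_of_nonneg_left h1 (by positivity)
      linarith
  unfold nbrSum
  rw [← Finset.sum_sub_distrib]
  refine (Finset.abs_sum_le_sum_abs _ _).trans ((Finset.sum_le_sum fun i _ => key i).trans ?_)
  rw [Finset.sum_add_distrib, ← Finset.mul_sum, Finset.sum_comm]
  have hcol : ∀ j, ∑ i, (G i j : ℝ) * ((degree G j : ℝ) - degree H j) ≤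
      B * ((degree G j : ℝ) - degree H j) := by
    intro j
    rw [← Finset.sum_mul]
    refine mul_le_mul_of_nonneg_right ?_ (sub_nonneg.2 (hd' j))
    refine le_trans (le_of_eq ?_) (hB j)
    rw [degree]
    push_cast
    exact Finset.sum_congr rfl fun i _ => by rw [hsymm]
  have := Finset.sum_le_sum fun j (_ : j ∈ Finset.univ) => hcol j
  rw [← Finset.mul_sum] at this
  unfold lostEdges
  linarith

theorem abs_nodeCount_sub_le {d e : Fin n → ℕ} (h : ∀ i, e i ≤ d i) (k : ℕ) :
    |nodeCount e k - nodeCount d k| ≤ ∑ i, ((d i : ℝ) - e i) := by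
  unfold nodeCount
  rw [← Finset.sum_sub_distrib]
  refine (Finset.abs_sum_le_sum_abs _ _).trans (Finset.sum_le_sum fun i _ => ?_)
  rcases (h i).eq_or_lt with h | h
  · simp [h]
  · have h1 : (1 : ℝ) ≤ (d i : ℝ) - e i := by
      rw [le_sub_iff_add_le]; exact_mod_cast (by omega)
    refine le_trans ?_ h1
    split_ifs <;> simp

/-- By `hW` at least `N / 2` nodes of degree `k` survive, whence the factor `2 / N`. The coefficient
`2 * k + 1` is `k + 1` from the numerator plus `k` from the node count, using `q ≤ B`. -/
theorem abs_annd_sub_le {G H : Matrix (Fin n) (Fin n) ℕ} (hle : ∀ i j, H i j ≤ G i j)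
    (hsymm : ∀ i j, G i j = G j i) {k : ℕ} (hk : 1 ≤ k) {B q N : ℝ}
    (hB : ∀ i, (degree G i : ℝ) ≤ B) (hq : 0 ≤ q) (hqB : q ≤ B) (hN : 0 < N)
    (hNG : N ≤ nodeCount (degree G) k) (hW : lostEdges G H ≤ N / 2) :
    |annd H k - q| ≤ (2 / N) * (|nbrSum G k - k * nodeCount (degree G) k * q| +
      (2 * k + 1) * B * lostEdges G H) := by
  have hd : ∀ i, degree H i ≤ degree G i := fun i => Finset.sum_le_sum fun j _ => hle i j
  have h1 := abs_nbrSum_sub_le hle hsymm k hB (hq.trans hqB)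
  have h2 := abs_nodeCount_sub_le hd k
  change _ ≤ lostEdges G H at h2
  have hNH : N / 2 ≤ nodeCount (degree H) k := by linarith [(abs_le.1 h2).1]
  have hNH0 : 0 < nodeCount (degree H) k := by linarith
  have hk1 : (1 : ℝ) ≤ k := by exact_mod_cast hk
  have hpos : 0 < (k : ℝ) * nodeCount (degree H) k := by positivity
  have hW0 : 0 ≤ lostEdges G H := Finset.sum_nonneg fun i _ => sub_nonneg.2 (by exact_mod_cast hd i)
  have h3 : |nbrSum H k - k * nodeCount (degree H) k * q| ≤
      |nbrSum G k - k * nodeCount (degree G) k * q| + (2 * k + 1) * B * lostEdges G H := by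
    have e : nbrSum H k - k * nodeCount (degree H) k * q =
      (nbrSum G k - k * nodeCount (degree G) k * q) + (nbrSum H k - nbrSum G k) -
        k * q * (nodeCount (degree H) k - nodeCount (degree G) k) := by ring
    have h4 : |k * q * (nodeCount (degree H) k - nodeCount (degree G) k)| ≤
        k * B * lostEdges G H := by
      rw [abs_mul, abs_of_nonneg (by positivity : 0 ≤ (k : ℝ) * q)]
      exact mul_le_mul (by gcongr) h2 (abs_nonneg _) (by have := hq.trans hqB; positivity)
    rw [e]
    refine (abs_sub _ _).trans ?_
    have := abs_add_le (nbrSum G k - k * nodeCount (degree G) k * q) (nbrSum H k - nbrSum G k)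
    linarith
  rw [annd_eq H hk hNH0]
  have e : nbrSum H k / (k * nodeCount (degree H) k) - q =
      (nbrSum H k - k * nodeCount (degree H) k * q) / (k * nodeCount (degree H) k) := by
    field_simp
  rw [e, abs_div, abs_of_pos hpos, div_le_iff₀ hpos]
  refine h3.trans ?_
  have h5 : 1 ≤ 2 / N * (k * nodeCount (degree H) k) := by
    rw [div_mul_eq_mul_div, le_div_iff₀ hN]
    nlinarith
  have h6 : 0 ≤ |nbrSum G k - k * nodeCount (degree G) k * q| + (2 * k + 1) * B * lostEdges G H :=
    (abs_nonneg _).trans h3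
  calc _ ≤ (|nbrSum G k - k * nodeCount (degree G) k * q| +
        (2 * k + 1) * B * lostEdges G H) * (2 / N * (k * nodeCount (degree H) k)) :=
        le_mul_of_one_le_right h6 h5
    _ = _ := by ring

end Deterministic

/-! ### The multigraph of a pairing, in terms of stubs -/

section PairingGraph

variable {n : ℕ} {d : Fin n → ℕ}

theorem sum_stub_pair (m : Pairing d) (F : Fin n → Fin n → ℝ) :
    ∑ s : Stub d, F s.1 (m.1 s).1 = ∑ i, ∑ j, (pairingGraph d m i j : ℝ) * F i j := by
  rw [← Finset.sum_fiberwise (s := Finset.univ)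
    (g := fun s : Stub d => ((s.1, (m.1 s).1) : Fin n × Fin n)), Fintype.sum_prod_type]
  refine Finset.sum_congr rfl fun i _ => Finset.sum_congr rfl fun j _ => ?_
  rw [Finset.sum_congr rfl (g := fun _ => F i j)
    (by simp only [Finset.mem_filter, Prod.mk.injEq]; rintro s ⟨-, h1, h2⟩; rw [h1, h2])]
  simp [pairingGraph]

theorem sum_stub (F : Fin n → ℝ) : ∑ s : Stub d, F s.1 = ∑ i, (d i : ℝ) * F i := by
  rw [Fintype.sum_sigma]
  simp

theorem degree_pairingGraph (m : Pairing d) : degree (pairingGraph d m) = d := by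
  ext i
  have h1 := sum_stub_pair m (fun i' _ => if i' = i then 1 else 0)
  have h2 := sum_stub (d := d) (fun i' => if i' = i then 1 else 0)
  rw [h1] at h2
  simp only [mul_ite, mul_one, mul_zero] at h2
  rw [Finset.sum_comm] at h2
  simp only [Finset.sum_ite_eq', Finset.mem_univ, if_true] at h2
  rw [degree]
  exact_mod_cast h2

theorem pairingGraph_symm (m : Pairing d) (i j : Fin n) :
    pairingGraph d m i j = pairingGraph d m j i := by
  simp only [pairingGraph, Matrix.of_apply]
  refine Finset.card_bij' (fun s _ => m.1 s) (fun s _ => m.1 s) ?_ ?_ ?_ ?_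
  · intro s hs
    simp only [Finset.mem_filter, Finset.mem_univ, true_and, m.2.1 s] at hs ⊢
    exact hs.symm
  · intro s hs
    simp only [Finset.mem_filter, Finset.mem_univ, true_and, m.2.1 s] at hs ⊢
    exact hs.symm
  · intro s _; exact m.2.1 s
  · intro s _; exact m.2.1 s

theorem erase_le (G : Matrix (Fin n) (Fin n) ℕ) (i j : Fin n) : erase G i j ≤ G i j := by
  simp only [erase, Matrix.of_apply]
  split_ifs with h
  · exact h.2
  · exact Nat.zero_le _

theorem nbrSum_pairingGraph (m : Pairing d) (k : ℕ) :
    nbrSum (pairingGraph d m) k =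
      ∑ s : Stub d, if d s.1 = k then (d (m.1 s).1 : ℝ) else 0 := by
  rw [sum_stub_pair m (fun i j => if d i = k then (d j : ℝ) else 0)]
  unfold nbrSum
  rw [degree_pairingGraph]
  refine Finset.sum_congr rfl fun i _ => ?_
  split_ifs <;> simp

/-- The second sum counts ordered pairs of distinct parallel stubs, that is `g * (g - 1)` for an
entry `g`. For `g ≥ 1` this dominates the off-diagonal loss `g - 1`; on the diagonal the two sums
give `g ^ 2 ≥ g`. -/
theorem lostEdges_erase_le (m : Pairing d) :
    lostEdges (pairingGraph d m) (erase (pairingGraph d m)) ≤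
      (∑ s : Stub d, if (m.1 s).1 = s.1 then (1 : ℝ) else 0) +
      ∑ s : Stub d, ∑ s' ∈ Finset.univ.filter (fun s' : Stub d => s'.1 = s.1 ∧ s' ≠ s),
        if (m.1 s').1 = (m.1 s).1 then (1 : ℝ) else 0 := by
  set G := pairingGraph d m with hG
  have h1 : ∀ s : Stub d,
      ∑ s' ∈ Finset.univ.filter (fun s' : Stub d => s'.1 = s.1 ∧ s' ≠ s),
        (if (m.1 s').1 = (m.1 s).1 then (1 : ℝ) else 0) = (G s.1 (m.1 s).1 : ℝ) - 1 := by
    intro s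
    have h2 : ∑ s' : Stub d, (if s'.1 = s.1 ∧ (m.1 s').1 = (m.1 s).1 then (1 : ℝ) else 0) =
        (G s.1 (m.1 s).1 : ℝ) := by
      simp [hG, pairingGraph]
    rw [← h2, ← Finset.add_sum_erase _ _ (Finset.mem_univ s)]
    simp only [and_self, if_true, add_sub_cancel_left]
    rw [Finset.sum_filter, ← Finset.add_sum_erase _ _ (Finset.mem_univ s)]
    simp only [ne_eq, not_true_eq_false, and_false, if_false, zero_add]
    refine Finset.sum_congr rfl fun s' hs' => ?_
    have : s' ≠ s := by simpa using hs'
    by_cases a : s'.1 = s.1 <;> simp [a, this]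
  rw [Finset.sum_congr rfl fun s _ => h1 s, ← Finset.sum_add_distrib,
    sum_stub_pair m (fun i j => (if j = i then (1 : ℝ) else 0) + ((G i j : ℝ) - 1)), ← hG]
  unfold lostEdges degree
  push_cast
  simp only [← Finset.sum_sub_distrib]
  refine Finset.sum_le_sum fun i _ => Finset.sum_le_sum fun j _ => ?_
  simp only [erase, Matrix.of_apply]
  rcases Nat.eq_zero_or_pos (G i j) with h0 | h0
  · simp [h0]
  · have h0' : (1 : ℝ) ≤ G i j := by exact_mod_cast h0
    by_cases h : i = j
    · simp only [h, ne_eq, not_true_eq_false, false_and, if_false, if_true]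
      rw [h] at h0'
      push_cast
      nlinarith
    · simp only [h, Ne.symm h, ne_eq, not_false_eq_true, true_and, h0, if_true, if_false]
      push_cast
      nlinarith

end PairingGraph

/-! ### Second moment of a linear statistic of a uniform matching -/

section MatchMean

variable {α : Type*} [Fintype α]

theorem matchMean_add (X Y : Matching α → ℝ) :
    matchMean (fun m => X m + Y m) = matchMean X + matchMean Y := by
  simp only [matchMean, Finset.sum_add_distrib, add_div]

theorem matchMean_const_mul (c : ℝ) (X : Matching α → ℝ) :
    matchMean (fun m => c * X m) = c * matchMean X := by
  simp only [matchMean, ← Finset.mul_sum, mul_div_assoc]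

theorem matchMean_sum {ι : Type*} (S : Finset ι) (X : ι → Matching α → ℝ) :
    matchMean (fun m => ∑ i ∈ S, X i m) = ∑ i ∈ S, matchMean (X i) := by
  simp only [matchMean]
  rw [Finset.sum_comm, Finset.sum_div]

theorem matchMean_mono {X Y : Matching α → ℝ} (h : ∀ m, X m ≤ Y m) :
    matchMean X ≤ matchMean Y := by
  unfold matchMean
  gcongr with m
  exact h m

/-- Markov's inequality for the uniform perfect matching. -/
theorem card_filter_le_matchMean {X : Matching α → ℝ} (hX : ∀ m, 0 ≤ X m) {t : ℝ} (ht : 0 < t) :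
    ((Finset.univ.filter fun m => t < X m).card : ℝ) / Fintype.card (Matching α) ≤
      matchMean X / t := by
  have h : ((Finset.univ.filter fun m => t < X m).card : ℝ) / Fintype.card (Matching α) =
      matchMean (fun m => if t < X m then (1 : ℝ) else 0) := by
    simp [matchMean]
  rw [h, le_div_iff₀ ht, mul_comm, ← matchMean_const_mul]
  refine matchMean_mono fun m => ?_
  split_ifs with h
  · linarith
  · simpa using hX m

variable [Nonempty (Matching α)]

theorem matchMean_const (c : ℝ) : matchMean (fun _ : Matching α => c) = c := by
  have : (0 : ℝ) < Fintype.card (Matching α) := by exact_mod_cast Fintype.card_pos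
  simp [matchMean, this.ne']

variable [DecidableEq α]

/-- Expanding the square cancels the leading term `(M * S / L) ^ 2`. The four errors come, in order,
from the diagonal `s = s'`, from `s` and `s'` matched together, from replacing `(L - 1) * (L - 3)`
by `L ^ 2`, and from excluding `s` itself as a partner. Since `b = κ` on the support of `a`, the
exact mean is available. -/
theorem matchMean_sum_sub_sq_le (hL : 6 ≤ (Fintype.card α : ℝ)) {a b : α → ℝ} {κ : ℝ}
    (ha0 : ∀ s, 0 ≤ a s) (ha1 : ∀ s, a s ≤ 1) (hb : ∀ s, 0 ≤ b s) (hκ : 0 ≤ κ)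
    (hab : ∀ s, a s * b s = a s * κ) (hκS : κ ≤ ∑ t, b t) :
    matchMean (fun m => (∑ s, a s * b (m.1 s) -
        (∑ s, a s) * (∑ t, b t) / Fintype.card α) ^ 2) ≤
      2 * (∑ t, b t ^ 2) + 2 * κ ^ 2 * Fintype.card α +
        16 * (∑ t, b t) ^ 2 / Fintype.card α + 2 * (∑ t, b t) * κ := by
  set L : ℝ := (Fintype.card α : ℝ) with hLdef
  set M : ℝ := ∑ s, a s with hM
  set S : ℝ := ∑ t, b t with hS
  set S₂ : ℝ := ∑ t, b t ^ 2 with hS₂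
  have hL1 : 0 < L - 1 := by linarith
  have hL3 : 0 < L - 3 := by linarith
  have hL0 : 0 < L := by linarith
  have hM0 : 0 ≤ M := Finset.sum_nonneg fun s _ => ha0 s
  have hS0 : 0 ≤ S := Finset.sum_nonneg fun s _ => hb s
  have hS₂0 : 0 ≤ S₂ := Finset.sum_nonneg fun s _ => sq_nonneg _
  have hML : M ≤ L := by
    calc M ≤ ∑ _s : α, (1 : ℝ) := Finset.sum_le_sum fun s _ => ha1 s
      _ = L := by simp [hLdef]
  have hmean : matchMean (fun m : Matching α => ∑ s, a s * b (m.1 s)) = M * (S - κ) / (L - 1) := by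
    rw [matchMean_sum, hM, mul_div_assoc, Finset.sum_mul]
    refine Finset.sum_congr rfl fun s _ => ?_
    rw [matchMean_const_mul, matchMean_apply (by linarith), ← mul_div_assoc, ← mul_div_assoc,
      mul_sub, mul_sub, hab]
  have hsq : matchMean (fun m : Matching α => (∑ s, a s * b (m.1 s)) ^ 2) ≤
      M * (S₂ / (L - 1)) + M ^ 2 * (κ ^ 2 / (L - 1) + S ^ 2 / ((L - 1) * (L - 3))) := by
    have e1 : ∀ m : Matching α, (∑ s, a s * b (m.1 s)) ^ 2 =
        ∑ s, ∑ s', a s * a s' * (b (m.1 s) * b (m.1 s')) := by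
      intro m
      rw [sq, Finset.sum_mul_sum]
      exact Finset.sum_congr rfl fun s _ => Finset.sum_congr rfl fun s' _ => by ring
    have e2 : M * (S₂ / (L - 1)) + M ^ 2 * (κ ^ 2 / (L - 1) + S ^ 2 / ((L - 1) * (L - 3))) =
        ∑ s, ∑ s', ((if s' = s then a s * (S₂ / (L - 1)) else 0) +
          a s * a s' * (κ ^ 2 / (L - 1) + S ^ 2 / ((L - 1) * (L - 3)))) := by
      simp only [Finset.sum_add_distrib, ← Finset.sum_mul, ← Finset.mul_sum]
      simp only [Finset.sum_ite_eq', Finset.mem_univ, if_true, ← Finset.sum_mul]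
      rw [sq M]
    simp only [e1]
    rw [matchMean_sum, e2]
    refine Finset.sum_le_sum fun s _ => ?_
    rw [matchMean_sum]
    refine Finset.sum_le_sum fun s' _ => ?_
    rw [matchMean_const_mul]
    have hnn : 0 ≤ κ ^ 2 / (L - 1) + S ^ 2 / ((L - 1) * (L - 3)) := by positivity
    by_cases h : s' = s
    · subst h
      rw [if_pos rfl, matchMean_apply (by linarith) s' (fun t => b t * b t)]
      have h1 : a s' * a s' ≤ a s' := mul_le_of_le_one_right (ha0 _) (ha1 _)
      have h2 : (∑ t, b t * b t - b s' * b s') / (L - 1) ≤ S₂ / (L - 1) := by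
        gcongr
        have : ∑ t, b t * b t = S₂ := Finset.sum_congr rfl fun t _ => (sq _).symm
        rw [this]
        linarith [mul_self_nonneg (b s')]
      have h3 : 0 ≤ S₂ / (L - 1) := by positivity
      have h4 : 0 ≤ a s' * a s' := mul_self_nonneg _
      have h5 := mul_le_mul_of_nonneg_left h2 h4
      have h6 := mul_le_mul_of_nonneg_right h1 h3
      have h7 := mul_nonneg h4 hnn
      linarith
    · rw [if_neg h, zero_add]
      have h1 := matchMean_apply₂_le (by linarith) (Ne.symm h) (fun t t' => b t * b t')
        (fun t t' => mul_nonneg (hb _) (hb _))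
      have h2 := mul_le_mul_of_nonneg_left h1 (mul_nonneg (ha0 s) (ha0 s'))
      refine h2.trans (le_of_eq ?_)
      rw [← Finset.sum_mul_sum, ← hS, mul_add, mul_add, ← sq S]
      congr 1
      have : a s * a s' * (b s' * b s) = a s * a s' * κ ^ 2 := by
        calc a s * a s' * (b s' * b s) = (a s * b s) * (a s' * b s') := by ring
          _ = _ := by rw [hab, hab]; ring
      rw [← mul_div_assoc, this, mul_div_assoc]
  have e3 : ∀ m : Matching α, (∑ s, a s * b (m.1 s) - M * S / L) ^ 2 =
      (∑ s, a s * b (m.1 s)) ^ 2 + ((-(2 * (M * S / L))) * (∑ s, a s * b (m.1 s)) +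
        (M * S / L) ^ 2) := by intro m; ring
  simp only [e3]
  rw [matchMean_add, matchMean_add, matchMean_const_mul, hmean, matchMean_const]
  have hinv : 1 / (L - 1) ≤ 2 / L := by
    rw [div_le_div_iff₀ hL1 hL0]; linarith
  have b1 : M * (S₂ / (L - 1)) ≤ 2 * S₂ := by
    rw [div_eq_mul_one_div]
    calc M * (S₂ * (1 / (L - 1))) ≤ L * (S₂ * (2 / L)) := by gcongr
      _ = 2 * S₂ := by field_simp
  have b2 : M ^ 2 * (κ ^ 2 / (L - 1)) ≤ 2 * κ ^ 2 * L := by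
    rw [div_eq_mul_one_div]
    calc M ^ 2 * (κ ^ 2 * (1 / (L - 1))) ≤ L ^ 2 * (κ ^ 2 * (2 / L)) := by gcongr
      _ = _ := by field_simp
  -- The coefficient of `1 / L ^ 2` must be exactly `1` for the cancellation; `16` is a generous
  -- constant for `L ≥ 6`.
  have hinv2 : 1 / ((L - 1) * (L - 3)) ≤ 1 / L ^ 2 + 16 / L ^ 3 := by
    have : 1 / L ^ 2 + 16 / L ^ 3 = (L + 16) / L ^ 3 := by field_simp
    rw [this, div_le_div_iff₀ (by positivity) (by positivity)]
    nlinarith [mul_nonneg hL0.le (sub_nonneg.2 hL), sq_nonneg L]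
  have b3 : M ^ 2 * (S ^ 2 / ((L - 1) * (L - 3))) ≤ (M * S / L) ^ 2 + 16 * S ^ 2 / L := by
    rw [div_eq_mul_one_div]
    calc M ^ 2 * (S ^ 2 * (1 / ((L - 1) * (L - 3)))) ≤
          M ^ 2 * (S ^ 2 * (1 / L ^ 2 + 16 / L ^ 3)) := by gcongr
      _ = (M * S / L) ^ 2 + M ^ 2 * (16 * S ^ 2 / L ^ 3) := by field_simp
      _ ≤ (M * S / L) ^ 2 + L ^ 2 * (16 * S ^ 2 / L ^ 3) := by gcongr
      _ = _ := by field_simp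
  -- The cross term enters with a minus sign, so the mean is bounded from below; this needs `κ ≤ S`.
  have b4 : 2 * (M * S / L) * (M * (S - κ) / L) ≤ 2 * (M * S / L) * (M * (S - κ) / (L - 1)) := by
    have : 0 ≤ S - κ := by linarith
    gcongr
    linarith
  have b5 : 2 * (M * S / L) * (M * (S - κ) / L) = 2 * (M * S / L) ^ 2 -
      2 * S * κ * (M / L) ^ 2 := by field_simp
  have b6 : 2 * S * κ * (M / L) ^ 2 ≤ 2 * S * κ := by
    have : M / L ≤ 1 := (div_le_one hL0).2 hML
    have : (M / L) ^ 2 ≤ 1 := pow_le_one₀ (by positivity) this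
    exact mul_le_of_le_one_right (by positivity) this
  rw [mul_add (M ^ 2)] at hsq
  linarith

end MatchMean

/-! ### Moment bounds for the configuration model with given degrees -/

section PairingMean

variable {n : ℕ} {d : Fin n → ℕ}

theorem card_stub : (Fintype.card (Stub d) : ℝ) = ∑ i, (d i : ℝ) := by simp

theorem sum_degree_stub : ∑ s : Stub d, (d s.1 : ℝ) = ∑ i, (d i : ℝ) ^ 2 := by
  rw [sum_stub (fun i => (d i : ℝ))]
  simp only [sq]

variable [Nonempty (Pairing d)]

/-- A stub is paired within its own node with probability at most `d / (L - 1)`. At most `Q` ordered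
pairs of stubs share a node, and each pair lands on a common node with probability `O(1 / L + Q / L
^ 2)`. The total `4 * r + 4 * r ^ 2` is at most `8 * r ^ 2` because `r = Q / L ≥ 1`. -/
theorem matchMean_lostEdges_le (hL : 6 ≤ ∑ i, (d i : ℝ)) :
    matchMean (α := Stub d)
        (fun m => lostEdges (pairingGraph d m) (erase (pairingGraph d m))) ≤
      8 * ((∑ i, (d i : ℝ) ^ 2) / ∑ i, (d i : ℝ)) ^ 2 := by
  have hc := card_stub (d := d)
  set L : ℝ := ∑ i, (d i : ℝ) with hLdef
  set Q : ℝ := ∑ i, (d i : ℝ) ^ 2 with hQ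
  have hL1 : 0 < L - 1 := by linarith
  have hL3 : 0 < L - 3 := by linarith
  have hL0 : 0 < L := by linarith
  have hLQ : L ≤ Q := Finset.sum_le_sum fun i _ => by
    have : d i ≤ d i ^ 2 := Nat.le_self_pow two_ne_zero _
    exact_mod_cast this
  have hQ0 : 0 ≤ Q := by linarith
  have hcount : ∀ s : Stub d, ∑ t : Stub d, (if t.1 = s.1 then (1 : ℝ) else 0) = d s.1 := by
    intro s
    rw [sum_stub (fun i => if i = s.1 then (1 : ℝ) else 0)]
    simp
  have h1 : ∀ s : Stub d, matchMean (α := Stub d) (fun m => if (m.1 s).1 = s.1 then (1 : ℝ) else 0)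
      ≤ d s.1 / (L - 1) := by
    intro s
    rw [matchMean_apply (by rw [hc]; linarith) s (fun t => if t.1 = s.1 then (1 : ℝ) else 0),
      hcount, hc]
    gcongr
    simp
  have h2 : ∀ s s' : Stub d, s' ≠ s →
      matchMean (α := Stub d) (fun m => if (m.1 s').1 = (m.1 s).1 then (1 : ℝ) else 0)
      ≤ 1 / (L - 1) + Q / ((L - 1) * (L - 3)) := by
    intro s s' hs
    have := matchMean_apply₂_le (α := Stub d) (by rw [hc]; linarith) hs
      (fun t t' => if t.1 = t'.1 then (1 : ℝ) else 0) (fun t t' => by split_ifs <;> simp)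
    refine this.trans ?_
    rw [hc]
    have e : ∑ t : Stub d, ∑ t' : Stub d, (if t.1 = t'.1 then (1 : ℝ) else 0) = Q := by
      rw [Finset.sum_comm, Finset.sum_congr rfl fun s _ => hcount s, sum_degree_stub]
    rw [e]
    gcongr
    split_ifs <;> simp
  refine (matchMean_mono fun m => lostEdges_erase_le m).trans ?_
  rw [matchMean_add, matchMean_sum, matchMean_sum]
  have s1 : ∑ s : Stub d,
      matchMean (α := Stub d) (fun m => if (m.1 s).1 = s.1 then (1 : ℝ) else 0) ≤ Q / (L - 1) := by
    refine (Finset.sum_le_sum fun s _ => h1 s).trans (le_of_eq ?_)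
    rw [← Finset.sum_div, sum_degree_stub]
  have s2 : ∑ s : Stub d, matchMean (α := Stub d) (fun m =>
      ∑ s' ∈ Finset.univ.filter (fun s' : Stub d => s'.1 = s.1 ∧ s' ≠ s),
        if (m.1 s').1 = (m.1 s).1 then (1 : ℝ) else 0) ≤
      Q * (1 / (L - 1) + Q / ((L - 1) * (L - 3))) := by
    have hC : 0 ≤ 1 / (L - 1) + Q / ((L - 1) * (L - 3)) := by positivity
    generalize 1 / (L - 1) + Q / ((L - 1) * (L - 3)) = C at h2 hC ⊢
    rw [hQ, ← sum_degree_stub, Finset.sum_mul]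
    refine Finset.sum_le_sum fun s _ => ?_
    rw [matchMean_sum]
    refine (Finset.sum_le_sum (g := fun _ => C)
      fun s' hs' => h2 s s' (Finset.mem_filter.1 hs').2.2).trans ?_
    rw [Finset.sum_const, nsmul_eq_mul]
    refine mul_le_mul_of_nonneg_right ?_ hC
    have : (Finset.univ.filter (fun s' : Stub d => s'.1 = s.1 ∧ s' ≠ s)).card ≤
        (Finset.univ.filter (fun s' : Stub d => s'.1 = s.1)).card :=
      Finset.card_le_card fun x hx => by
        simp only [Finset.mem_filter] at hx ⊢
        exact ⟨hx.1, hx.2.1⟩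
    have h3 := hcount s
    rw [Finset.sum_boole] at h3
    rw [← h3]
    exact_mod_cast this
  have hinv : 1 / (L - 1) ≤ 2 / L := by
    rw [div_le_div_iff₀ hL1 hL0]; linarith
  have hinv3 : 1 / ((L - 1) * (L - 3)) ≤ 4 / L ^ 2 := by
    rw [div_le_div_iff₀ (by positivity) (by positivity)]; nlinarith
  have r : 1 ≤ Q / L := (one_le_div hL0).2 hLQ
  have t1 : Q / (L - 1) ≤ 2 * (Q / L) := by
    rw [div_eq_mul_one_div]
    calc Q * (1 / (L - 1)) ≤ Q * (2 / L) := by gcongr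
      _ = _ := by ring
  have t2 : Q * (1 / (L - 1) + Q / ((L - 1) * (L - 3))) ≤ 2 * (Q / L) + 4 * (Q / L) ^ 2 := by
    rw [div_eq_mul_one_div Q]
    calc Q * (1 / (L - 1) + Q * (1 / ((L - 1) * (L - 3)))) ≤ Q * (2 / L + Q * (4 / L ^ 2)) := by
          gcongr
      _ = _ := by field_simp
  nlinarith

theorem matchMean_nbrSum_sub_sq_le (hL : 6 ≤ ∑ i, (d i : ℝ)) {k : ℕ} (hk : ∃ i, d i = k)
    {B : ℝ} (hB : ∀ i, (d i : ℝ) ≤ B) :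
    matchMean (α := Stub d) (fun m => (nbrSum (pairingGraph d m) k -
        k * nodeCount d k * ((∑ i, (d i : ℝ) ^ 2) / ∑ i, (d i : ℝ))) ^ 2) ≤
      (∑ i, (d i : ℝ) ^ 2) * (2 * B + 2 * k ^ 2 +
        16 * ((∑ i, (d i : ℝ) ^ 2) / ∑ i, (d i : ℝ)) + 2 * k) := by
  have hc := card_stub (d := d)
  have hQs := sum_degree_stub (d := d)
  have hM : ∑ s : Stub d, (if d s.1 = k then (1 : ℝ) else 0) = k * nodeCount d k := by
    rw [sum_stub (fun i => if d i = k then (1 : ℝ) else 0), nodeCount, Finset.mul_sum]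
    refine Finset.sum_congr rfl fun i _ => ?_
    split_ifs with h <;> simp [h]
  have hLQ : ∑ i, (d i : ℝ) ≤ ∑ i, (d i : ℝ) ^ 2 := Finset.sum_le_sum fun i _ => by
    have : d i ≤ d i ^ 2 := Nat.le_self_pow two_ne_zero _
    exact_mod_cast this
  obtain ⟨i, hi⟩ := hk
  have hkL : (k : ℝ) ≤ ∑ i, (d i : ℝ) := by
    rw [← hi]
    exact Finset.single_le_sum (f := fun i => (d i : ℝ)) (fun _ _ => by positivity)
      (Finset.mem_univ i)
  have key := matchMean_sum_sub_sq_le (α := Stub d) (by rw [hc]; exact hL)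
    (a := fun s => if d s.1 = k then (1 : ℝ) else 0) (b := fun s => (d s.1 : ℝ)) (κ := k)
    (fun s => by split_ifs <;> simp) (fun s => by split_ifs <;> simp) (fun s => by positivity)
    (by positivity) (fun s => by split_ifs with h <;> simp [h]) (by rw [hQs]; linarith)
  rw [hc, hQs, hM, mul_div_assoc] at key
  simp only [nbrSum_pairingGraph]
  simp only [ite_mul, one_mul, zero_mul] at key
  refine key.trans ?_
  have h2 : ∑ s : Stub d, (d s.1 : ℝ) ^ 2 ≤ B * ∑ i, (d i : ℝ) ^ 2 := by
    rw [sum_stub (fun i => (d i : ℝ) ^ 2), Finset.mul_sum]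
    exact Finset.sum_le_sum fun i _ => mul_le_mul_of_nonneg_right (hB i) (by positivity)
  have h3 : 2 * (k : ℝ) ^ 2 * ∑ i, (d i : ℝ) ≤ 2 * (k : ℝ) ^ 2 * ∑ i, (d i : ℝ) ^ 2 := by gcongr
  have h4 : 16 * (∑ i, (d i : ℝ) ^ 2) ^ 2 / ∑ i, (d i : ℝ) =
    (∑ i, (d i : ℝ) ^ 2) * (16 * ((∑ i, (d i : ℝ) ^ 2) / ∑ i, (d i : ℝ))) := by ring
  rw [h4]
  nlinarith

end PairingMean

/-! ### Failure probability given the degrees -/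

section ConditionalBound

variable {n : ℕ}

/-- Chebyshev handles the pairing fluctuation and Markov the erasure. Each may reach `u * η / 4`,
since `(2 / u) * (2 * (u * η / 4)) = η`. -/
theorem card_bad_le (d : Fin n → ℕ) [Nonempty (Pairing d)] (hL : 6 ≤ ∑ i, (d i : ℝ)) {k : ℕ}
    (hk : 1 ≤ k) {B r u η : ℝ} (hB : ∀ i, (d i : ℝ) ≤ B) (hB1 : 1 ≤ B)
    (hr : (∑ i, (d i : ℝ) ^ 2) / ∑ i, (d i : ℝ) ≤ r) (hu : 0 < u) (hN : u ≤ nodeCount d k)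
    (hη : 0 < η) (hη1 : η ≤ 1) :
    ((Finset.univ.filter fun m : Pairing d => η < |annd (erase (pairingGraph d m)) k -
        (∑ i, (d i : ℝ) ^ 2) / ∑ i, (d i : ℝ)|).card : ℝ) / Fintype.card (Pairing d) ≤
      (∑ i, (d i : ℝ) ^ 2) * (2 * B + 2 * k ^ 2 + 16 * r + 2 * k) / (u * η / 4) ^ 2 +
        (2 * k + 1) * B * (8 * r ^ 2) / (u * η / 4) := by
  set L : ℝ := ∑ i, (d i : ℝ) with hLdef
  set Q : ℝ := ∑ i, (d i : ℝ) ^ 2 with hQ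
  have hL0 : 0 < L := by linarith
  have hQ0 : 0 ≤ Q := Finset.sum_nonneg fun i _ => sq_nonneg _
  have hr0 : 0 ≤ Q / L := by positivity
  have hQB : Q / L ≤ B := by
    rw [div_le_iff₀ hL0, hLdef, Finset.mul_sum]
    exact Finset.sum_le_sum fun i _ => by
      rw [sq]; exact mul_le_mul_of_nonneg_right (hB i) (by positivity)
  have hx : 0 < u * η / 4 := by positivity
  set x := u * η / 4 with hxdef
  have hki : ∃ i, d i = k := by
    by_contra! hc
    simp only [nodeCount, hc, if_false, Finset.sum_const_zero] at hN
    linarith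
  let T : Pairing d → ℝ := fun m => nbrSum (pairingGraph d m) k - k * nodeCount d k * (Q / L)
  let W : Pairing d → ℝ := fun m => lostEdges (pairingGraph d m) (erase (pairingGraph d m))
  have hW0 : ∀ m, 0 ≤ W m := fun m => Finset.sum_nonneg fun i _ => sub_nonneg.2 (by
    exact_mod_cast Finset.sum_le_sum fun j _ => erase_le _ i j)
  have hsub : (Finset.univ.filter fun m : Pairing d =>
      η < |annd (erase (pairingGraph d m)) k - Q / L|) ⊆
      (Finset.univ.filter fun m => x ^ 2 < T m ^ 2) ∪
        (Finset.univ.filter fun m => x < (2 * k + 1) * B * W m) := by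
    intro m hm
    simp only [Finset.mem_union, Finset.mem_filter, Finset.mem_univ, true_and] at hm ⊢
    by_contra! hc
    have h1 : |T m| ≤ x := abs_le_of_sq_le_sq hc.1 hx.le
    -- The same event also gives `W m ≤ u / 2`, as required to keep enough nodes of degree `k`.
    have h2 : W m ≤ (2 * k + 1) * B * W m := by
      have : (1 : ℝ) ≤ (2 * k + 1) * B := by
        have : (0 : ℝ) ≤ k := by positivity
        nlinarith
      exact le_mul_of_one_le_left (hW0 m) this
    have h3 := abs_annd_sub_le (erase_le (pairingGraph d m)) (pairingGraph_symm m) hk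
      (B := B) (q := Q / L) (N := u) (by rw [degree_pairingGraph]; exact hB) hr0 hQB hu
      (by rw [degree_pairingGraph]; exact hN)
      (by
        change W m ≤ _
        have : u * η ≤ u * 1 := by gcongr
        linarith [hc.2])
    rw [degree_pairingGraph] at h3
    have h4 : (2 / u) * (|T m| + (2 * k + 1) * B * W m) ≤ (2 / u) * (2 * x) := by
      gcongr
      linarith [hc.2]
    have h5 : (2 / u) * (2 * x) = η := by rw [hxdef]; field_simp; norm_num
    exact absurd hm (not_lt.2 (h3.trans (h4.trans h5.le)))
  have hP : (0 : ℝ) < Fintype.card (Pairing d) := by exact_mod_cast Fintype.card_pos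
  have hcard : ((Finset.univ.filter fun m : Pairing d =>
      η < |annd (erase (pairingGraph d m)) k - Q / L|).card : ℝ) ≤
      ((Finset.univ.filter fun m => x ^ 2 < T m ^ 2).card : ℝ) +
        (Finset.univ.filter fun m => x < (2 * k + 1) * B * W m).card := by
    exact_mod_cast (Finset.card_le_card hsub).trans (Finset.card_union_le _ _)
  have m1 := card_filter_le_matchMean (α := Stub d) (X := fun m => T m ^ 2)
    (fun m => sq_nonneg _) (t := x ^ 2) (by positivity)
  have m2 := card_filter_le_matchMean (α := Stub d) (X := fun m => (2 * k + 1) * B * W m)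
    (fun m => mul_nonneg (by positivity) (hW0 m)) hx
  rw [matchMean_const_mul] at m2
  have e1 := matchMean_nbrSum_sub_sq_le hL hki hB
  have e2 := matchMean_lostEdges_le (d := d) hL
  have hr2 : (Q / L) ^ 2 ≤ r ^ 2 := by gcongr
  calc _ ≤ _ := div_le_div_of_nonneg_right hcard hP.le
    _ = _ := add_div _ _ _
    _ ≤ _ := add_le_add m1 m2
    _ ≤ _ := by
      refine add_le_add ?_ ?_
      · refine div_le_div_of_nonneg_right (e1.trans ?_) (by positivity)
        gcongr
      · refine div_le_div_of_nonneg_right ?_ hx.le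
        refine mul_le_mul_of_nonneg_left (e2.trans ?_) (by positivity)
        linarith

theorem toOuterMeasure_le_one {β : Type*} (q : PMF β) (s : Set β) : q.toOuterMeasure s ≤ 1 := by
  rw [PMF.toOuterMeasure_apply, ← q.tsum_coe]
  exact ENNReal.tsum_le_tsum fun a => Set.indicator_le_self _ _ a

theorem iidLaw_toOuterMeasure (p : PMF ℕ) (n : ℕ) (s : Set (Fin n → ℕ)) :
    (iidLaw p n).toOuterMeasure s = (Measure.pi fun _ : Fin n => p.toMeasure) s := by
  rw [← PMF.toMeasure_apply_eq_toOuterMeasure, iidLaw, Measure.toPMF_toMeasure]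

open Classical in
-- Conditioning on the sample: the conditional probability of `S` is at most `ε` on `A` and at most
-- `1` off it.
theorem erasedConfigurationModel_le (p : PMF ℕ) (S : Set (Matrix (Fin n) (Fin n) ℕ))
    (A : Set (Fin n → ℕ)) (ε : ℝ) (h : ∀ x ∈ A,
      ((Finset.univ.filter fun m : Pairing (parityCorrect x) =>
        erase (pairingGraph (parityCorrect x) m) ∈ S).card : ℝ) /
        Fintype.card (Pairing (parityCorrect x)) ≤ ε) :
    (erasedConfigurationModel p n).toOuterMeasure S ≤
      (Measure.pi fun _ : Fin n => p.toMeasure) Aᶜ + ENNReal.ofReal ε := by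
  rw [erasedConfigurationModel, configurationModel, PMF.map_bind, PMF.toOuterMeasure_bind_apply,
    ← iidLaw_toOuterMeasure, PMF.toOuterMeasure_apply]
  have h1 : ∑' x, (iidLaw p n) x * ENNReal.ofReal ε = ENNReal.ofReal ε := by
    rw [ENNReal.tsum_mul_right, PMF.tsum_coe, one_mul]
  rw [← h1, ← ENNReal.tsum_add]
  refine ENNReal.tsum_le_tsum fun x => ?_
  by_cases hx : x ∈ A
  · refine le_trans ?_ le_add_self
    gcongr
    rw [PMF.toOuterMeasure_map_apply, PMF.toOuterMeasure_map_apply,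
      PMF.toOuterMeasure_uniformOfFintype_apply]
    have hP : (0 : ℝ) < Fintype.card (Pairing (parityCorrect x)) := by
      exact_mod_cast Fintype.card_pos
    refine le_trans (le_of_eq ?_) (ENNReal.ofReal_le_ofReal (h x hx))
    rw [ENNReal.ofReal_div_of_pos hP, ENNReal.ofReal_natCast, ENNReal.ofReal_natCast,
      Fintype.card_subtype]
    congr 3
  · refine le_trans ?_ le_self_add
    rw [Set.indicator_of_mem (by simpa using hx)]
    exact mul_le_of_le_one_right zero_le (toOuterMeasure_le_one _ _)

end ConditionalBound

/-! ### Finite moments and the choice of exponents -/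

section Moments

/-- A Potter-type bound. If `l` is nondecreasing, each doubling eventually multiplies it by less
than `2 ^ ε`, and monotonicity interpolates between the points `2 ^ j * x₁`. If it is nonincreasing,
it is bounded above. -/
theorem SlowlyVarying.le_const_mul_rpow {l : ℝ → ℝ} (hl : SlowlyVarying l)
    (hm : EventuallyMonotone l) {ε : ℝ} (hε : 0 < ε) :
    ∃ C : ℝ, ∀ᶠ x in atTop, l x ≤ C * x ^ ε := by
  obtain ⟨x₀, hmono | hanti⟩ := hm
  · have h2 : (1 : ℝ) < 2 ^ ε := Real.one_lt_rpow one_lt_two hε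
    have hev := (hl.2 2 two_pos).eventually (gt_mem_nhds h2)
    obtain ⟨x₁, hx₁⟩ := eventually_atTop.1 ((hev.and hl.1).and
      ((eventually_ge_atTop x₀).and (eventually_ge_atTop 1)))
    have hx1 := (hx₁ x₁ le_rfl).2
    have hx1pos : 0 < x₁ := by linarith [hx1.2]
    have hl1 : 0 < l x₁ := (hx₁ x₁ le_rfl).1.2
    have hstep : ∀ j : ℕ, l (2 ^ j * x₁) ≤ ((2 : ℝ) ^ j) ^ ε * l x₁ := by
      intro j
      induction j with
      | zero => simp
      | succ j ih =>
        have hge : x₁ ≤ 2 ^ j * x₁ := le_mul_of_one_le_left hx1pos.le (one_le_pow₀ one_le_two)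
        have h3 := (hx₁ _ hge).1
        have h4 := h3.1
        rw [div_lt_iff₀ h3.2] at h4
        calc l (2 ^ (j + 1) * x₁) = l (2 * (2 ^ j * x₁)) := by ring_nf
          _ ≤ 2 ^ ε * l (2 ^ j * x₁) := h4.le
          _ ≤ 2 ^ ε * (((2 : ℝ) ^ j) ^ ε * l x₁) := by gcongr
          _ = ((2 : ℝ) ^ (j + 1)) ^ ε * l x₁ := by
            rw [pow_succ', Real.mul_rpow (by positivity) (by positivity), mul_assoc]
    refine ⟨2 ^ ε * l x₁, eventually_atTop.2 ⟨x₁, fun x hx => ?_⟩⟩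
    obtain ⟨j, hj1, hj2⟩ := exists_nat_pow_near ((one_le_div hx1pos).2 hx) one_lt_two
    rw [le_div_iff₀ hx1pos] at hj1
    rw [div_lt_iff₀ hx1pos] at hj2
    have hle : (2 : ℝ) ^ j ≤ x := le_trans (le_mul_of_one_le_right (by positivity) hx1.2) hj1
    calc l x ≤ l (2 ^ (j + 1) * x₁) :=
          hmono (hx1.1.trans hx) (hx1.1.trans (hx.trans hj2.le)) hj2.le
      _ ≤ ((2 : ℝ) ^ (j + 1)) ^ ε * l x₁ := hstep _
      _ = 2 ^ ε * l x₁ * ((2 : ℝ) ^ j) ^ ε := by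
        rw [pow_succ', Real.mul_rpow (by positivity) (by positivity)]; ring
      _ ≤ 2 ^ ε * l x₁ * x ^ ε := by gcongr
  · refine ⟨|l x₀|, ?_⟩
    filter_upwards [eventually_ge_atTop x₀, eventually_ge_atTop 1] with x hx hx1
    calc l x ≤ l x₀ := hanti Set.self_mem_Ici hx hx
      _ ≤ |l x₀| * 1 := by rw [mul_one]; exact le_abs_self _
      _ ≤ |l x₀| * x ^ ε := by gcongr; exact Real.one_le_rpow hx1 hε.le

/-- Half of the gap `γ - s` absorbs the slowly varying factor; the other half gives summability. -/
theorem RegularlyVarying.summable_rpow_mul_density {p : PMF ℕ} {γ s : ℝ}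
    (hp : RegularlyVarying p γ) (hs : s < γ) :
    Summable fun k : ℕ => (k : ℝ) ^ s * density p k := by
  obtain ⟨l, hl, hm, hd⟩ := hp
  obtain ⟨C, hC⟩ := hl.le_const_mul_rpow hm (half_pos (sub_pos.2 hs))
  have hsum : Summable fun k : ℕ => C * (k : ℝ) ^ (-1 - (γ - s) / 2) :=
    (Real.summable_nat_rpow.2 (by linarith)).mul_left C
  refine Summable.of_norm_bounded_eventually_nat hsum ?_
  filter_upwards [tendsto_natCast_atTop_atTop.eventually hC, eventually_ge_atTop 1] with k hk hk1
  have hk0 : (0 : ℝ) < k := by exact_mod_cast hk1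
  have hdn : 0 ≤ density p k := ENNReal.toReal_nonneg
  rw [Real.norm_of_nonneg (by positivity), hd k hk1]
  calc (k : ℝ) ^ s * (l k * (k : ℝ) ^ (-γ - 1)) ≤
        (k : ℝ) ^ s * (C * (k : ℝ) ^ ((γ - s) / 2) * (k : ℝ) ^ (-γ - 1)) := by gcongr
    _ = C * ((k : ℝ) ^ s * (k : ℝ) ^ ((γ - s) / 2) * (k : ℝ) ^ (-γ - 1)) := by ring
    _ = C * (k : ℝ) ^ (-1 - (γ - s) / 2) := by
      rw [← Real.rpow_add hk0, ← Real.rpow_add hk0]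
      ring_nf

theorem integrable_of_summable_density {p : PMF ℕ} {g : ℕ → ℝ}
    (h : Summable fun k : ℕ => ‖g k‖ * density p k) : Integrable g p.toMeasure := by
  refine ⟨Measurable.aestronglyMeasurable (measurable_of_countable g), ?_⟩
  rw [HasFiniteIntegral, lintegral_countable']
  have e : ∀ k, ‖g k‖ₑ * p.toMeasure {k} = ENNReal.ofReal (‖g k‖ * density p k) := by
    intro k
    rw [ENNReal.ofReal_mul (norm_nonneg _), ofReal_norm, density,
      ENNReal.ofReal_toReal (p.apply_ne_top k), PMF.toMeasure_apply_singleton _ _ (by simp)]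
  simp only [e]
  exact h.tsum_ofReal_lt_top

theorem RegularlyVarying.integrable_rpow {p : PMF ℕ} {γ s : ℝ}
    (hp : RegularlyVarying p γ) (hs : s < γ) :
    Integrable (fun k : ℕ => (k : ℝ) ^ s) p.toMeasure := by
  refine integrable_of_summable_density ?_
  convert hp.summable_rpow_mul_density hs using 2 with k
  rw [Real.norm_of_nonneg (by positivity)]

/-- Moments of order `s` are used, degrees are cut at `n ^ a`, and `δ'` is the rate for the
empirical moments. The last four inequalities control, in order, the maximum degree, the truncation
bias, the truncated variance and the pairing error. At the limit `s = γ`, `a = 1 / γ`, `δ' = δ`, all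
are strict except `1 < a * s`, so a small perturbation suffices. -/
theorem exists_exponents {γ δ : ℝ} (hγ : 2 < γ) (hδ : 0 < δ)
    (hδ_lt : δ < (γ - 1) / (2 * (γ + 3))) (hδ_lt' : δ < 1 - 2 / γ) :
    ∃ s a δ' : ℝ, 2 < s ∧ s < γ ∧ 0 < a ∧ δ < δ' ∧ 1 < a * s ∧ δ' < a * (s - 2) ∧
      a * max (4 - s) 0 + 2 * δ' < 1 ∧ a + 2 * δ' < 1 := by
  have hγ0 : 0 < γ := by linarith
  have h1 : δ * (2 * (γ + 3)) < γ - 1 := (lt_div_iff₀ (by linarith)).1 hδ_lt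
  have h2 : δ < γ⁻¹ * (γ - 2) := by
    have : γ⁻¹ * (γ - 2) = 1 - 2 / γ := by field_simp
    rwa [this]
  have h3 : γ⁻¹ * max (4 - γ) 0 + 2 * δ < 1 := by
    rcases le_total (4 - γ) 0 with h | h
    · rw [max_eq_right h]; nlinarith
    · rw [max_eq_left h]
      have : γ⁻¹ * (4 - γ) = 4 / γ - 1 := by field_simp
      have : 2 / γ * 2 = 4 / γ := by ring
      linarith
  have h4 : γ⁻¹ + 2 * δ < 1 := by
    have : γ⁻¹ * γ = 1 := inv_mul_cancel₀ hγ0.ne'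
    nlinarith [mul_pos hδ hγ0]
  have c1 : Tendsto (fun ε : ℝ => (γ - 2 * ε)⁻¹) (𝓝[>] 0) (𝓝 γ⁻¹) := by
    have : ContinuousAt (fun ε : ℝ => (γ - 2 * ε)⁻¹) 0 :=
      ContinuousAt.inv₀ (by fun_prop) (by simpa using hγ0.ne')
    have := this.tendsto.mono_left (nhdsWithin_le_nhds (s := Set.Ioi 0))
    simpa using this
  have c2 : Tendsto (fun ε : ℝ => γ - ε) (𝓝[>] 0) (𝓝 γ) := by
    have : ContinuousAt (fun ε : ℝ => γ - ε) 0 := by fun_prop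
    simpa using this.tendsto.mono_left (nhdsWithin_le_nhds (s := Set.Ioi 0))
  have c3 : Tendsto (fun ε : ℝ => δ + ε) (𝓝[>] 0) (𝓝 δ) := by
    have : ContinuousAt (fun ε : ℝ => δ + ε) 0 := by fun_prop
    simpa using this.tendsto.mono_left (nhdsWithin_le_nhds (s := Set.Ioi 0))
  have e1 := c2.eventually (lt_mem_nhds hγ)
  have e2 := c3.eventually_lt (c1.mul (c2.sub_const 2)) h2
  have e3 := ((c1.mul ((c2.const_sub 4).max tendsto_const_nhds)).add
    (c3.const_mul 2)).eventually (gt_mem_nhds h3)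
  have e4 := (c1.add (c3.const_mul 2)).eventually (gt_mem_nhds h4)
  have e5 : ∀ᶠ ε : ℝ in 𝓝[>] 0, 0 < ε := eventually_mem_nhdsWithin
  have e6 : ∀ᶠ ε : ℝ in 𝓝[>] 0, ε < 1 / 2 :=
    (gt_mem_nhds (by norm_num : (0 : ℝ) < 1 / 2)).filter_mono nhdsWithin_le_nhds
  obtain ⟨ε, ⟨⟨⟨⟨⟨a1, a2⟩, a3⟩, a4⟩, a5⟩, a6⟩⟩ :=
    (((((e1.and e2).and e3).and e4).and e5).and e6).exists
  have hpos : 0 < γ - 2 * ε := by linarith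
  -- Shifting `γ` by `2 * ε` in `a` but only by `ε` in `s` makes `a * s` exceed `1`.
  refine ⟨γ - ε, (γ - 2 * ε)⁻¹, δ + ε, a1, by linarith, inv_pos.2 hpos, by linarith, ?_, a2, a3, a4⟩
  rw [inv_mul_eq_div, one_lt_div hpos]
  linarith

end Moments

/-! ### Chebyshev and union bounds for independent samples -/

section IID

variable (p : PMF ℕ) (n : ℕ)

theorem pi_abs_sum_sub_ge_le {g : ℕ → ℝ} (hg : MemLp g 2 p.toMeasure) {t : ℝ} (ht : 0 < t) :
    (Measure.pi fun _ : Fin n => p.toMeasure)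
        {x | t ≤ |∑ i, g (x i) - n * ∫ k, g k ∂p.toMeasure|} ≤
      ENNReal.ofReal (n * (∫ k, g k ^ 2 ∂p.toMeasure) / t ^ 2) := by
  have hcomp : ∀ i : Fin n, MemLp (fun x : Fin n → ℕ => g (x i)) 2
      (Measure.pi fun _ : Fin n => p.toMeasure) := fun i =>
    hg.comp_measurePreserving (measurePreserving_eval (fun _ : Fin n => p.toMeasure) i)
  have hsum : MemLp (∑ i : Fin n, fun x : Fin n → ℕ => g (x i)) 2
      (Measure.pi fun _ : Fin n => p.toMeasure) := memLp_finsetSum' _ fun i _ => hcomp i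
  have h := ProbabilityTheory.meas_ge_le_variance_div_sq hsum ht
  rw [ProbabilityTheory.variance_sum_pi (fun _ => hg)] at h
  have hmean : ∫ x, (∑ i : Fin n, fun x : Fin n → ℕ => g (x i)) x
      ∂(Measure.pi fun _ : Fin n => p.toMeasure) = n * ∫ k, g k ∂p.toMeasure := by
    simp only [Finset.sum_apply]
    rw [integral_finsetSum _ fun i _ => (hcomp i).integrable one_le_two]
    have : ∀ i : Fin n, ∫ x : Fin n → ℕ, g (x i) ∂(Measure.pi fun _ : Fin n => p.toMeasure) =
        ∫ k, g k ∂p.toMeasure := fun i =>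
      integral_comp_eval (μ := fun _ : Fin n => p.toMeasure) (i := i) hg.aestronglyMeasurable
    simp [this]
  rw [hmean] at h
  simp only [Finset.sum_apply] at h
  refine h.trans (ENNReal.ofReal_le_ofReal ?_)
  gcongr
  rw [Finset.sum_const, Finset.card_univ, Fintype.card_fin, nsmul_eq_mul]
  gcongr
  exact ProbabilityTheory.variance_le_expectation_sq hg.aestronglyMeasurable

theorem pi_exists_gt_le {s : ℝ} (hs : 0 ≤ s)
    (hint : Integrable (fun k : ℕ => (k : ℝ) ^ s) p.toMeasure) {y : ℝ} (hy : 0 < y) :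
    (Measure.pi fun _ : Fin n => p.toMeasure) {x | ∃ i, y < x i} ≤
      ENNReal.ofReal (n * (∫ k : ℕ, (k : ℝ) ^ s ∂p.toMeasure) / y ^ s) := by
  have hys : 0 < y ^ s := Real.rpow_pos_of_pos hy s
  have h1 : p.toMeasure {k : ℕ | y < k} ≤
      ENNReal.ofReal ((∫ k : ℕ, (k : ℝ) ^ s ∂p.toMeasure) / y ^ s) := by
    have hm := mul_meas_ge_le_integral_of_nonneg (μ := p.toMeasure)
      (f := fun k : ℕ => (k : ℝ) ^ s) (Eventually.of_forall fun k => by positivity) hint (y ^ s)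
    have hsub : {k : ℕ | y < k} ⊆ {k : ℕ | y ^ s ≤ (k : ℝ) ^ s} := fun k hk =>
      Real.rpow_le_rpow hy.le (le_of_lt hk) hs
    rw [ENNReal.le_ofReal_iff_toReal_le (measure_ne_top _ _)
      (by positivity), le_div_iff₀ hys, mul_comm]
    refine le_trans ?_ hm
    gcongr
    exact ENNReal.toReal_mono (measure_ne_top _ _) (measure_mono hsub)
  have e : {x : Fin n → ℕ | ∃ i, y < x i} = ⋃ i, Function.eval i ⁻¹' {k : ℕ | y < k} := by
    ext x; simp
  rw [e]
  refine (measure_iUnion_fintype_le _ _).trans ?_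
  have h2 : ∀ i : Fin n, (Measure.pi fun _ : Fin n => p.toMeasure)
      (Function.eval i ⁻¹' {k : ℕ | y < k}) = p.toMeasure {k : ℕ | y < k} := fun i =>
    (measurePreserving_eval (fun _ : Fin n => p.toMeasure) i).measure_preimage
      (MeasurableSet.of_discrete.nullMeasurableSet)
  rw [Finset.sum_congr rfl fun i _ => h2 i, Finset.sum_const, Finset.card_univ, Fintype.card_fin,
    nsmul_eq_mul, mul_div_assoc, ENNReal.ofReal_mul (by positivity), ENNReal.ofReal_natCast]
  gcongr

end IID

/-! ### Typical degree samples have probability tending to one -/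

section GoodDegrees

/-- The typical samples: no large degree, the first two empirical moments close to their means,
and many nodes of degree `k`. -/
def typicalSamples (p : PMF ℕ) (k : ℕ) (a b : ℝ) (n : ℕ) : Set (Fin n → ℕ) :=
  {x | (∀ i, (x i : ℝ) ≤ (n : ℝ) ^ a) ∧ |∑ i, (x i : ℝ) - n * nu p 1| < (n : ℝ) ^ (1 - b) ∧
    |∑ i, (x i : ℝ) ^ 2 - n * nu p 2| < (n : ℝ) ^ (1 - b) ∧
    n * density p k / 2 < nodeCount x k}

theorem tendsto_const_mul_natCast_rpow_zero (C : ℝ) {e : ℝ} (he : e < 0) :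
    Tendsto (fun n : ℕ => C * (n : ℝ) ^ e) atTop (𝓝 0) := by
  have h := (tendsto_rpow_neg_atTop (neg_pos.2 he)).comp (tendsto_natCast_atTop_atTop (R := ℝ))
  simpa [Function.comp_def] using h.const_mul C

variable (p : PMF ℕ) {s : ℝ}

theorem integrable_natCast_pow (hs : 2 < s)
    (hint : Integrable (fun k : ℕ => (k : ℝ) ^ s) p.toMeasure) {r : ℕ} (hr : r ≤ 2) :
    Integrable (fun k : ℕ => (k : ℝ) ^ r) p.toMeasure := by
  refine ((integrable_const (1 : ℝ)).add hint).mono'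
    (measurable_of_countable _).aestronglyMeasurable (Eventually.of_forall fun k => ?_)
  rw [Real.norm_of_nonneg (by positivity), Pi.add_apply]
  rcases Nat.eq_zero_or_pos k with rfl | hk
  · rcases Nat.eq_zero_or_pos r with rfl | hr0
    · simp [Real.zero_rpow (by linarith : s ≠ 0)]
    · simp [Real.zero_rpow (by linarith : s ≠ 0), hr0.ne']
  · have hk1 : (1 : ℝ) ≤ k := by exact_mod_cast hk
    have : (k : ℝ) ^ r ≤ (k : ℝ) ^ s := by
      rw [← Real.rpow_natCast]
      refine Real.rpow_le_rpow_of_exponent_le hk1 ?_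
      have : (r : ℝ) ≤ 2 := by exact_mod_cast hr
      linarith
    linarith

theorem memLp_truncated {y : ℝ} :
    MemLp (fun k : ℕ => if (k : ℝ) ≤ y then (k : ℝ) ^ 2 else 0) 2 p.toMeasure := by
  refine MemLp.of_bound (measurable_of_countable _).aestronglyMeasurable (y ^ 2)
    (Eventually.of_forall fun k => ?_)
  split_ifs with h
  · rw [Real.norm_of_nonneg (by positivity)]
    gcongr
  · rw [norm_zero]; positivity

theorem nu_two_sub_truncated_le (hs : 2 < s)
    (hint : Integrable (fun k : ℕ => (k : ℝ) ^ s) p.toMeasure) {y : ℝ} (hy : 0 < y) :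
    |∫ k : ℕ, (if (k : ℝ) ≤ y then (k : ℝ) ^ 2 else 0) ∂p.toMeasure - nu p 2| ≤
      (∫ k : ℕ, (k : ℝ) ^ s ∂p.toMeasure) / y ^ (s - 2) := by
  have hI := integrable_natCast_pow p hs hint le_rfl
  have hT : Integrable (fun k : ℕ => if (k : ℝ) ≤ y then (k : ℝ) ^ 2 else 0) p.toMeasure :=
    (memLp_truncated p).integrable one_le_two
  unfold nu
  rw [← integral_sub hT hI, ← integral_div, ← Real.norm_eq_abs]
  refine norm_integral_le_of_norm_le (hint.div_const _) (Eventually.of_forall fun k => ?_)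
  have hys : 0 < y ^ (s - 2) := Real.rpow_pos_of_pos hy _
  split_ifs with h
  · rw [sub_self, norm_zero]; positivity
  · rw [zero_sub, norm_neg, Real.norm_of_nonneg (by positivity), le_div_iff₀ hys]
    have hk : y < k := not_le.1 h
    have hk0 : (0 : ℝ) < k := hy.trans hk
    calc (k : ℝ) ^ 2 * y ^ (s - 2) ≤ (k : ℝ) ^ 2 * (k : ℝ) ^ (s - 2) := by
          gcongr
      _ = (k : ℝ) ^ s := by
        rw [← Real.rpow_natCast, ← Real.rpow_add hk0]
        norm_num

/-- For `1 ≤ k ≤ y`, `k ^ 4` is at most `k ^ s * y ^ (4 - s)` if `s < 4` and at most `k ^ s`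
otherwise; the `max` covers both cases. -/
theorem integral_truncated_sq_le (hs : 2 < s)
    (hint : Integrable (fun k : ℕ => (k : ℝ) ^ s) p.toMeasure) {y : ℝ} (hy : 0 < y) :
    ∫ k : ℕ, (if (k : ℝ) ≤ y then (k : ℝ) ^ 2 else 0) ^ 2 ∂p.toMeasure ≤
      (∫ k : ℕ, (k : ℝ) ^ s ∂p.toMeasure) * y ^ max (4 - s) 0 := by
  rw [← integral_mul_const]
  refine integral_mono_of_nonneg (Eventually.of_forall fun k => sq_nonneg _)
    (hint.mul_const _) (Eventually.of_forall fun k => ?_)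
  dsimp only
  split_ifs with h
  · rcases Nat.eq_zero_or_pos k with rfl | hk
    · simp [Real.zero_rpow (by linarith : s ≠ 0)]
    · have hk1 : (1 : ℝ) ≤ k := by exact_mod_cast hk
      have hk0 : (0 : ℝ) < k := by linarith
      calc ((k : ℝ) ^ 2) ^ 2 = (k : ℝ) ^ (4 : ℝ) := by
            rw [← pow_mul]; norm_cast
        _ ≤ (k : ℝ) ^ (s + max (4 - s) 0) :=
            Real.rpow_le_rpow_of_exponent_le hk1 (by linarith [le_max_left (4 - s) 0])
        _ = (k : ℝ) ^ s * (k : ℝ) ^ max (4 - s) 0 := Real.rpow_add hk0 _ _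
        _ ≤ _ := by
          gcongr
  · rw [zero_pow two_ne_zero]
    exact mul_nonneg (by positivity) (Real.rpow_nonneg hy.le _)

/-- `D ^ 2` may have infinite variance, so Chebyshev is applied to its truncation at `n ^ a`, which
changes nothing when no degree exceeds that level. Half of the tolerance `n ^ (1 - b)` pays for the
truncation bias and half for the fluctuation. -/
theorem tendsto_pi_typicalSamples_compl (hs : 2 < s)
    (hint : Integrable (fun k : ℕ => (k : ℝ) ^ s) p.toMeasure) {k : ℕ} (hk : 0 < density p k)
    {a b : ℝ} (ha : 0 < a) (has : 1 < a * s) (hb : b < a * (s - 2))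
    (hab : a * max (4 - s) 0 + 2 * b < 1) :
    Tendsto (fun n : ℕ => (Measure.pi fun _ : Fin n => p.toMeasure) (typicalSamples p k a b n)ᶜ)
      atTop (𝓝 0) := by
  set m := ∫ k : ℕ, (k : ℝ) ^ s ∂p.toMeasure with hm
  have hm0 : 0 ≤ m := integral_nonneg fun k => by positivity
  have hI2 := integrable_natCast_pow p hs hint (r := 2) le_rfl
  have hb2 : 2 * b < 1 := by
    have := mul_nonneg ha.le (le_max_right (4 - s) 0)
    linarith
  set θ := max (4 - s) 0 with hθ
  have hlim : Tendsto (fun n : ℕ => ENNReal.ofReal (m * (n : ℝ) ^ (1 - a * s)) +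
      (ENNReal.ofReal (nu p 2 * (n : ℝ) ^ (2 * b - 1)) +
      (ENNReal.ofReal (4 * m * (n : ℝ) ^ (a * θ + 2 * b - 1)) +
      ENNReal.ofReal (4 / density p k ^ 2 * (n : ℝ) ^ (-1 : ℝ))))) atTop (𝓝 0) := by
    have z : ∀ (C e : ℝ), e < 0 → Tendsto (fun n : ℕ => ENNReal.ofReal (C * (n : ℝ) ^ e)) atTop
        (𝓝 0) := fun C e he => by
      simpa using ENNReal.tendsto_ofReal (tendsto_const_mul_natCast_rpow_zero C he)
    simpa using (z m _ (by linarith : 1 - a * s < 0)).add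
      ((z (nu p 2) _ (by linarith : 2 * b - 1 < 0)).add
      ((z (4 * m) _ (by linarith : a * θ + 2 * b - 1 < 0)).add (z _ (-1) (by norm_num))))
  have hbias := (tendsto_const_mul_natCast_rpow_zero m (by linarith : b - a * (s - 2) < 0)).eventually
    (gt_mem_nhds (by norm_num : (0 : ℝ) < 1 / 2))
  refine tendsto_of_tendsto_of_tendsto_of_le_of_le' tendsto_const_nhds hlim
    (Eventually.of_forall fun n => zero_le) ?_
  filter_upwards [hbias, eventually_gt_atTop 0] with n hn hn0
  have hn0' : (0 : ℝ) < n := by exact_mod_cast hn0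
  set y : ℝ := (n : ℝ) ^ a with hy
  set t : ℝ := (n : ℝ) ^ (1 - b) with ht
  have hy0 : 0 < y := Real.rpow_pos_of_pos hn0' _
  have ht0 : 0 < t := Real.rpow_pos_of_pos hn0' _
  have ht2 : t ^ 2 = (n : ℝ) ^ (2 - 2 * b) := by
    rw [ht, ← Real.rpow_natCast, ← Real.rpow_mul hn0'.le]; push_cast; ring_nf
  set g : ℕ → ℝ := fun k => if (k : ℝ) ≤ y then (k : ℝ) ^ 2 else 0 with hg
  set h : ℕ → ℝ := fun j => if j = k then 1 else 0 with hh
  have hhint : ∫ j, h j ∂p.toMeasure = density p k := by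
    have : h = Set.indicator {k} (fun _ => (1 : ℝ)) := by
      ext j; simp [hh, Set.indicator_apply]
    rw [this, integral_indicator_const _ (by simp), Measure.real,
      PMF.toMeasure_apply_singleton _ _ (by simp)]
    simp [density]
  have hhmem : MemLp h 2 p.toMeasure := by
    refine MemLp.of_bound (measurable_of_countable _).aestronglyMeasurable 1
      (Eventually.of_forall fun j => ?_)
    simp only [hh]
    split_ifs <;> simp
  have h1mem : MemLp (fun k : ℕ => (k : ℝ)) 2 p.toMeasure :=
    (memLp_two_iff_integrable_sq (measurable_of_countable _).aestronglyMeasurable).2 hI2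
  have P1 := pi_exists_gt_le p n (by linarith : 0 ≤ s) hint hy0
  have P2 := pi_abs_sum_sub_ge_le p n h1mem ht0
  have P3 := pi_abs_sum_sub_ge_le p n (memLp_truncated p (y := y)) (half_pos ht0)
  have P4 := pi_abs_sum_sub_ge_le p n hhmem (t := n * density p k / 2) (by positivity)
  have hbias' : n * |∫ k, g k ∂p.toMeasure - nu p 2| ≤ t / 2 := by
    have q := nu_two_sub_truncated_le p hs hint hy0
    have e : n * (m / y ^ (s - 2)) = t * (m * (n : ℝ) ^ (b - a * (s - 2))) := by
      rw [hy, ← Real.rpow_mul hn0'.le, div_eq_mul_inv, ← Real.rpow_neg hn0'.le, ht]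
      calc (n : ℝ) * (m * (n : ℝ) ^ (-(a * (s - 2)))) =
            m * ((n : ℝ) ^ (1 : ℝ) * (n : ℝ) ^ (-(a * (s - 2)))) := by rw [Real.rpow_one]; ring
        _ = m * ((n : ℝ) ^ (1 - b) * (n : ℝ) ^ (b - a * (s - 2))) := by
          rw [← Real.rpow_add hn0', ← Real.rpow_add hn0']; ring_nf
        _ = _ := by ring
    calc n * |∫ k, g k ∂p.toMeasure - nu p 2| ≤ n * (m / y ^ (s - 2)) := by gcongr
      _ = t * (m * (n : ℝ) ^ (b - a * (s - 2))) := e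
      _ ≤ t * (1 / 2) := by gcongr
      _ = t / 2 := by ring
  have hsub : (typicalSamples p k a b n)ᶜ ⊆ {x : Fin n → ℕ | ∃ i, y < x i} ∪
      ({x | t ≤ |∑ i, (x i : ℝ) - n * ∫ k : ℕ, (k : ℝ) ∂p.toMeasure|} ∪
      ({x | t / 2 ≤ |∑ i, g (x i) - n * ∫ k, g k ∂p.toMeasure|} ∪
      {x | n * density p k / 2 ≤ |∑ i, h (x i) - n * ∫ k, h k ∂p.toMeasure|})) := by
    intro x hx
    by_contra hc
    simp only [Set.mem_union, Set.mem_ofPred_eq, not_or, not_exists, not_lt, not_le] at hc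
    obtain ⟨c1, c2, c3, c4⟩ := hc
    apply hx
    refine ⟨c1, ?_, ?_, ?_⟩
    · simpa [nu] using c2
    · have e : ∑ i, g (x i) = ∑ i, (x i : ℝ) ^ 2 :=
        Finset.sum_congr rfl fun i _ => by simp only [hg]; rw [if_pos (c1 i)]
      rw [e] at c3
      have e2 : ∑ i, (x i : ℝ) ^ 2 - n * nu p 2 = (∑ i, (x i : ℝ) ^ 2 - n * ∫ k, g k ∂p.toMeasure)
        + n * (∫ k, g k ∂p.toMeasure - nu p 2) := by ring
      rw [e2]
      refine (abs_add_le _ _).trans_lt ?_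
      rw [abs_mul, abs_of_pos hn0']
      linarith
    · rw [hhint] at c4
      have : nodeCount x k = ∑ i, h (x i) := rfl
      rw [this]
      linarith [(abs_lt.1 c4).1]
  refine (measure_mono hsub).trans ((measure_union_le _ _).trans (add_le_add ?_
    ((measure_union_le _ _).trans (add_le_add ?_ ((measure_union_le _ _).trans
      (add_le_add ?_ ?_))))))
  · refine P1.trans (ENNReal.ofReal_le_ofReal (le_of_eq ?_))
    rw [hy, ← Real.rpow_mul hn0'.le, Real.rpow_sub hn0', Real.rpow_one]
    ring
  · refine P2.trans (ENNReal.ofReal_le_ofReal (le_of_eq ?_))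
    rw [ht2, mul_comm (n : ℝ), mul_div_assoc, nu]
    congr 1
    rw [div_eq_iff (Real.rpow_pos_of_pos hn0' _).ne', ← Real.rpow_add hn0']
    ring_nf
    rw [Real.rpow_one]
  · refine P3.trans (ENNReal.ofReal_le_ofReal ?_)
    have q := integral_truncated_sq_le p hs hint hy0
    have e : (t / 2) ^ 2 = (n : ℝ) ^ (2 - 2 * b) / 4 := by rw [div_pow, ht2]; norm_num
    rw [e, div_le_iff₀ (div_pos (Real.rpow_pos_of_pos hn0' _) four_pos)]
    calc _ ≤ (n : ℝ) * (m * y ^ θ) := by gcongr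
      _ = m * ((n : ℝ) ^ (1 : ℝ) * (n : ℝ) ^ (a * θ)) := by
        rw [hy, ← Real.rpow_mul hn0'.le, Real.rpow_one]; ring
      _ = m * ((n : ℝ) ^ (a * θ + 2 * b - 1) * (n : ℝ) ^ (2 - 2 * b)) := by
        rw [← Real.rpow_add hn0', ← Real.rpow_add hn0']; ring_nf
      _ = _ := by ring
  · refine P4.trans (ENNReal.ofReal_le_ofReal ?_)
    have e : ∫ j, h j ^ 2 ∂p.toMeasure ≤ 1 := by
      have : ∀ j, h j ^ 2 = h j := fun j => by simp only [hh]; split_ifs <;> simp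
      simp only [this, hhint]
      exact ENNReal.toReal_le_of_le_ofReal zero_le_one (by simpa using p.coe_le_one k)
    rw [div_le_iff₀ (by positivity), Real.rpow_neg_one]
    calc (n : ℝ) * ∫ j, h j ^ 2 ∂p.toMeasure ≤ n * 1 := by gcongr
      _ = _ := by field_simp; norm_num

end GoodDegrees

/-! ### The parity correction changes at most one degree, by one -/

section Parity

variable {n : ℕ} (x : Fin n → ℕ)

/-- The indicator of the last node. -/
def lastIndicator (i : Fin n) : ℝ := if (i : ℕ) + 1 = n then 1 else 0

theorem sum_lastIndicator_le : ∑ i : Fin n, lastIndicator i ≤ 1 := by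
  unfold lastIndicator
  rw [Finset.sum_boole]
  have : (Finset.univ.filter fun i : Fin n => (i : ℕ) + 1 = n).card ≤ 1 := by
    refine Finset.card_le_one.2 fun a ha b hb => Fin.ext ?_
    simp only [Finset.mem_filter, Finset.mem_univ, true_and] at ha hb
    omega
  exact_mod_cast this

theorem le_parityCorrect (i : Fin n) : (x i : ℝ) ≤ parityCorrect x i := by
  unfold parityCorrect
  push_cast
  split_ifs <;> simp

theorem parityCorrect_le (i : Fin n) : (parityCorrect x i : ℝ) ≤ x i + lastIndicator i := by
  unfold parityCorrect lastIndicator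
  push_cast
  split_ifs <;> simp_all

theorem lastIndicator_nonneg (i : Fin n) : 0 ≤ lastIndicator i := by
  unfold lastIndicator; split_ifs <;> simp

theorem lastIndicator_le_one (i : Fin n) : lastIndicator i ≤ 1 := by
  unfold lastIndicator; split_ifs <;> simp

theorem sum_parityCorrect_le : ∑ i, (parityCorrect x i : ℝ) ≤ ∑ i, (x i : ℝ) + 1 := by
  have := Finset.sum_le_sum fun i (_ : i ∈ Finset.univ) => parityCorrect_le x i
  rw [Finset.sum_add_distrib] at this
  linarith [sum_lastIndicator_le (n := n)]

theorem sum_sq_parityCorrect_le {y : ℝ} (hy : 0 ≤ y) (hx : ∀ i, (x i : ℝ) ≤ y) :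
    ∑ i, (parityCorrect x i : ℝ) ^ 2 ≤ ∑ i, (x i : ℝ) ^ 2 + (2 * y + 1) := by
  have h : ∀ i, (parityCorrect x i : ℝ) ^ 2 ≤ (x i : ℝ) ^ 2 + (2 * y + 1) * lastIndicator i := by
    intro i
    have h1 := parityCorrect_le x i
    have h2 := lastIndicator_nonneg i
    have h3 := lastIndicator_le_one i
    have h4 : (parityCorrect x i : ℝ) ^ 2 ≤ (x i + lastIndicator i) ^ 2 := by gcongr
    nlinarith [mul_le_mul_of_nonneg_right (hx i) h2]
  have := Finset.sum_le_sum fun i (_ : i ∈ Finset.univ) => h i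
  rw [Finset.sum_add_distrib, ← Finset.mul_sum] at this
  have h5 := mul_le_mul_of_nonneg_left (sum_lastIndicator_le (n := n))
    (by linarith : 0 ≤ 2 * y + 1)
  linarith

theorem nodeCount_le_nodeCount_parityCorrect (k : ℕ) :
    nodeCount x k ≤ nodeCount (parityCorrect x) k + 1 := by
  have h : ∀ i, (if x i = k then (1 : ℝ) else 0) ≤
      (if parityCorrect x i = k then 1 else 0) + lastIndicator i := by
    intro i
    unfold parityCorrect lastIndicator
    split_ifs <;> simp_all
  have := Finset.sum_le_sum fun i (_ : i ∈ Finset.univ) => h i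
  rw [Finset.sum_add_distrib] at this
  unfold nodeCount
  linarith [sum_lastIndicator_le (n := n)]

end Parity

/-! ### Numerical error estimates -/

theorem abs_div_sub_div_le {L Q n ν₁ ν₂ t : ℝ} (hn : 0 < n) (hν₁ : 0 < ν₁) (hν₂ : 0 ≤ ν₂)
    (hL : |L - n * ν₁| ≤ 2 * t) (hQ : |Q - n * ν₂| ≤ 4 * t) (hLn : n * ν₁ / 2 ≤ L) :
    |Q / L - ν₂ / ν₁| ≤ (8 * ν₁ + 4 * ν₂) / ν₁ ^ 2 * (t / n) := by
  have hL0 : 0 < L := by nlinarith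
  have e : Q / L - ν₂ / ν₁ = (ν₁ * (Q - n * ν₂) - ν₂ * (L - n * ν₁)) / (L * ν₁) := by
    field_simp
    ring
  have h1 : |ν₁ * (Q - n * ν₂) - ν₂ * (L - n * ν₁)| ≤ ν₁ * (4 * t) + ν₂ * (2 * t) := by
    refine (abs_sub _ _).trans ?_
    rw [abs_mul, abs_mul, abs_of_pos hν₁, abs_of_nonneg hν₂]
    gcongr
  have h0 := (abs_nonneg _).trans h1
  rw [e, abs_div, abs_of_pos (mul_pos hL0 hν₁)]
  calc _ ≤ (ν₁ * (4 * t) + ν₂ * (2 * t)) / (n * ν₁ / 2 * ν₁) := by gcongr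
    _ = _ := by field_simp; ring

/-- The explicit error bound has the order `y n ^ (2 δ - 1)`, where `y = n ^ a`. -/
theorem error_bound_le {n Q ν₂ r f a δ : ℝ} {k : ℕ} (hn1 : 1 ≤ n) (hν₂ : 0 ≤ ν₂) (hr0 : 0 < r)
    (hf : 0 < f) (hδ : 0 ≤ δ) (hy1 : 1 ≤ n ^ a) (hQn : Q ≤ n * (ν₂ + 4)) :
    Q * (2 * (2 * n ^ a) + 2 * k ^ 2 + 16 * r + 2 * k) / (n * f / 4 * (n ^ (-δ) / 2) / 4) ^ 2 +
        (2 * k + 1) * (2 * n ^ a) * (8 * r ^ 2) / (n * f / 4 * (n ^ (-δ) / 2) / 4) ≤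
      ((ν₂ + 4) * (4 + 2 * k ^ 2 + 16 * r + 2 * k) / (f / 32) ^ 2 +
        (2 * k + 1) * 2 * (8 * r ^ 2) / (f / 32)) * n ^ (a + 2 * δ - 1) := by
  have hn0 : 0 < n := by linarith
  have e0 : n ^ (a + 2 * δ - 1) * (n * (n ^ (-δ)) ^ 2) = n ^ a := by
    rw [← Real.rpow_natCast, ← Real.rpow_mul hn0.le]
    nth_rewrite 2 [← Real.rpow_one n]
    rw [← Real.rpow_add hn0, ← Real.rpow_add hn0]
    congr 1
    push_cast
    ring
  have hη1 : n ^ (-δ) ≤ 1 := Real.rpow_le_one_of_one_le_of_nonpos hn1 (by linarith)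
  have hη0 : 0 < n ^ (-δ) := Real.rpow_pos_of_pos hn0 _
  have hk0 : (0 : ℝ) ≤ k := by positivity
  set η := n ^ (-δ)
  set y := n ^ a
  set w := n ^ (a + 2 * δ - 1)
  have hux : n * f / 4 * (η / 2) / 4 = n * η * (f / 32) := by ring
  rw [hux]
  have e1 : y / (n * η ^ 2) = w := by
    rw [div_eq_iff (by positivity), e0]
  -- Since `η ≤ 1`, the Markov term is dominated by the order of the Chebyshev term.
  have e2 : y / (n * η) ≤ w := by
    rw [← e1]
    have : η ^ 2 ≤ η := pow_le_of_le_one hη0.le hη1 two_ne_zero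
    gcongr
  have b1 : Q * (2 * (2 * y) + 2 * k ^ 2 + 16 * r + 2 * k) ≤
      n * (ν₂ + 4) * ((4 + 2 * k ^ 2 + 16 * r + 2 * k) * y) := by
    have hz : 2 * (k : ℝ) ^ 2 + 16 * r + 2 * k ≤ (2 * (k : ℝ) ^ 2 + 16 * r + 2 * k) * y :=
      le_mul_of_one_le_right (by positivity) hy1
    have hz' : 2 * (2 * y) + 2 * k ^ 2 + 16 * r + 2 * k ≤
        (4 + 2 * (k : ℝ) ^ 2 + 16 * r + 2 * k) * y := by linarith
    gcongr
  refine (add_le_add ?_ ?_).trans (add_mul _ _ _).symm.le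
  · calc _ ≤ n * (ν₂ + 4) * ((4 + 2 * k ^ 2 + 16 * r + 2 * k) * y) / (n * η * (f / 32)) ^ 2 := by
          gcongr
      _ = (ν₂ + 4) * (4 + 2 * k ^ 2 + 16 * r + 2 * k) / (f / 32) ^ 2 * (y / (n * η ^ 2)) := by
          field_simp
      _ = _ := by rw [e1]
  · calc (2 * k + 1) * (2 * y) * (8 * r ^ 2) / (n * η * (f / 32)) =
          (2 * k + 1) * 2 * (8 * r ^ 2) / (f / 32) * (y / (n * η)) := by field_simp
      _ ≤ _ := by gcongr

/-! ### Combining typical degrees with the pairing bound -/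

section Main

variable (p : PMF ℕ)

/-- For a typical sample, the average nearest neighbour degree is close to `ν₂ / ν₁` for most
pairings. -/
theorem exists_card_bad_le {k : ℕ} (hk : 1 ≤ k) (hf : 0 < density p k) (hν₁ : 0 < nu p 1)
    (hν₂ : 0 ≤ nu p 2) {a b δ : ℝ} (ha : 0 < a) (hδ : 0 < δ) (hδb : δ < b)
    (hab : a + 2 * b < 1) :
    ∃ C : ℝ, ∀ᶠ n : ℕ in atTop, ∀ x ∈ typicalSamples p k a b n,
      ((Finset.univ.filter fun m : Pairing (parityCorrect x) =>
        (n : ℝ) ^ (-δ) < |annd (erase (pairingGraph (parityCorrect x) m)) k -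
          nu p 2 / nu p 1|).card : ℝ) / Fintype.card (Pairing (parityCorrect x)) ≤
        C * (n : ℝ) ^ (a + 2 * δ - 1) := by
  set ν₁ := nu p 1 with hν₁def
  set ν₂ := nu p 2 with hν₂def
  set f := density p k with hfdef
  set r := ν₂ / ν₁ + 1 with hr
  have hr0 : 0 < r := by positivity
  refine ⟨(ν₂ + 4) * (4 + 2 * k ^ 2 + 16 * r + 2 * k) / (f / 32) ^ 2 +
    (2 * k + 1) * 2 * (8 * r ^ 2) / (f / 32), ?_⟩
  have l1 := (tendsto_const_mul_natCast_rpow_zero ((8 * ν₁ + 4 * ν₂) / ν₁ ^ 2)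
    (by linarith : δ - b < 0)).eventually (gt_mem_nhds (by norm_num : (0 : ℝ) < 1 / 2))
  have l2 := (tendsto_const_mul_natCast_rpow_zero 2
    (by linarith : -b < 0)).eventually (gt_mem_nhds (by positivity : (0 : ℝ) < ν₁ / 2))
  have l3 : ∀ᶠ n : ℕ in atTop, 4 / f ≤ n := tendsto_natCast_atTop_atTop.eventually_ge_atTop _
  have l4 : ∀ᶠ n : ℕ in atTop, 12 / ν₁ ≤ n := tendsto_natCast_atTop_atTop.eventually_ge_atTop _
  filter_upwards [l1, l2, l3, l4, eventually_ge_atTop 1] with n h1 h2 h3 h4 hn1 x hx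
  obtain ⟨x1, x2, x3, x4⟩ := hx
  rw [← hν₁def] at x2
  rw [← hν₂def] at x3
  rw [← hfdef] at x4
  have hn1' : (1 : ℝ) ≤ n := by exact_mod_cast hn1
  have hn0 : (0 : ℝ) < n := by linarith
  set t : ℝ := (n : ℝ) ^ (1 - b) with ht
  set y : ℝ := (n : ℝ) ^ a with hy
  have hy1 : 1 ≤ y := Real.one_le_rpow hn1' ha.le
  have hyt : y ≤ t := Real.rpow_le_rpow_of_exponent_le hn1' (by linarith)
  have htn : t / n = (n : ℝ) ^ (-b) := by
    rw [ht, sub_eq_add_neg, Real.rpow_add hn0, Real.rpow_one]; field_simp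
  have htn1 : t ≤ n := by
    calc t ≤ (n : ℝ) ^ (1 : ℝ) := Real.rpow_le_rpow_of_exponent_le hn1' (by linarith)
      _ = n := Real.rpow_one _
  set d := parityCorrect x with hd
  have hdx := le_parityCorrect x
  have hsum_ge : ∑ i, (x i : ℝ) ≤ ∑ i, (d i : ℝ) := Finset.sum_le_sum fun i _ => hdx i
  have hsum_le : ∑ i, (d i : ℝ) ≤ ∑ i, (x i : ℝ) + 1 := sum_parityCorrect_le x
  have hsq_ge : ∑ i, (x i : ℝ) ^ 2 ≤ ∑ i, (d i : ℝ) ^ 2 := Finset.sum_le_sum fun i _ => by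
    have := hdx i
    gcongr
  have hsq_le : ∑ i, (d i : ℝ) ^ 2 ≤ ∑ i, (x i : ℝ) ^ 2 + (2 * y + 1) :=
    sum_sq_parityCorrect_le x (by linarith) x1
  set L : ℝ := ∑ i, (d i : ℝ) with hL
  set Q : ℝ := ∑ i, (d i : ℝ) ^ 2 with hQ
  have x2' := abs_lt.1 x2
  have x3' := abs_lt.1 x3
  -- The parity correction adds at most `1` to `L` and `2 * y + 1` to `Q`, absorbed using `1 ≤ y ≤
  -- t`.
  have hLabs : |L - n * ν₁| ≤ 2 * t := abs_le.2 ⟨by linarith, by linarith⟩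
  have hQabs : |Q - n * ν₂| ≤ 4 * t := abs_le.2 ⟨by linarith, by linarith⟩
  have hLn : n * ν₁ / 2 ≤ L := by
    have : 2 * t ≤ n * (ν₁ / 2) := by
      calc 2 * t = n * (2 * (n : ℝ) ^ (-b)) := by rw [← htn]; field_simp
        _ ≤ _ := by gcongr
    linarith [(abs_le.1 hLabs).1]
  have hL6 : 6 ≤ L := by
    rw [div_le_iff₀ hν₁] at h4
    linarith
  have hηeq : (n : ℝ) ^ (δ - b) * (n : ℝ) ^ (-δ) = (n : ℝ) ^ (-b) := by
    rw [← Real.rpow_add hn0]; ring_nf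
  set η : ℝ := (n : ℝ) ^ (-δ) with hη
  have hη0 : 0 < η := Real.rpow_pos_of_pos hn0 _
  have hη1 : η ≤ 1 := Real.rpow_le_one_of_one_le_of_nonpos hn1' (by linarith)
  -- Half of the tolerance is spent on `Q / L` against `ν₂ / ν₁`, possible because `δ < b`; the
  -- other half is left for the pairing.
  have hratio : |Q / L - ν₂ / ν₁| ≤ η / 2 := by
    refine (abs_div_sub_div_le hn0 hν₁ hν₂ hLabs hQabs hLn).trans ?_
    rw [htn, ← hηeq, ← mul_assoc]
    calc _ ≤ 1 / 2 * η := by gcongr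
      _ = η / 2 := by ring
  have hQLr : Q / L ≤ r := by
    have := (abs_le.1 hratio).2
    rw [hr]; linarith
  have hdB : ∀ i, (d i : ℝ) ≤ 2 * y := fun i => by
    have := parityCorrect_le x i
    have := lastIndicator_le_one i
    linarith [x1 i]
  -- The parity correction may cost one of the `n * f / 2` nodes, and `n * f ≥ 4`.
  have hN : n * f / 4 ≤ nodeCount d k := by
    have := nodeCount_le_nodeCount_parityCorrect x k
    rw [div_le_iff₀ hf] at h3
    linarith
  have hu : 0 < n * f / 4 := by positivity
  have main := card_bad_le d hL6 hk hdB (by linarith) hQLr hu hN (half_pos hη0) (by linarith)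
  have hP : (0 : ℝ) < Fintype.card (Pairing d) := by exact_mod_cast Fintype.card_pos
  refine (div_le_div_of_nonneg_right (Nat.cast_le.2 (Finset.card_le_card ?_)) hP.le).trans
    (main.trans ?_)
  · intro m hm
    simp only [Finset.mem_filter, Finset.mem_univ, true_and] at hm ⊢
    have := abs_sub_le (annd (erase (pairingGraph d m)) k) (Q / L) (ν₂ / ν₁)
    linarith
  · have hQn : Q ≤ n * (ν₂ + 4) := by
      have := (abs_le.1 hQabs).2
      linarith
    exact error_bound_le hn1' hν₂ hr0 hf hδ.le hy1 hQn

end Main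

end ECM
end

theorem mainTheorem10 (p : PMF ℕ) (γ : ℝ) (hγ : 2 < γ) (hp : ECM.RegularlyVarying p γ)
    (k : ℕ) (hk : 0 < ECM.sizeBiased p k)
    (δ : ℝ) (hδ : 0 < δ) (hδ_lt : δ < (γ - 1) / (2 * (γ + 3))) (hδ_lt' : δ < 1 - 2 / γ) :
    Filter.Tendsto
      (fun n : ℕ => (ECM.erasedConfigurationModel p n).toOuterMeasure
        {G | (n : ℝ) ^ (-δ) < |ECM.annd G k - ECM.nu p 2 / ECM.nu p 1|})
      Filter.atTop (nhds 0) := by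
  have hν₁0 : 0 ≤ ECM.nu p 1 := MeasureTheory.integral_nonneg fun k => by positivity
  have hν₂ : 0 ≤ ECM.nu p 2 := MeasureTheory.integral_nonneg fun k => by positivity
  have hf0 : 0 ≤ ECM.density p k := ENNReal.toReal_nonneg
  -- Division by zero gives `0`, so positivity of `sizeBiased` excludes `ν₁ = 0` as well as `f(k) =
  -- 0` and `k = 0`.
  have hν₁ : 0 < ECM.nu p 1 := by
    refine hν₁0.lt_of_ne fun h => ?_
    simp [ECM.sizeBiased, ← h] at hk
  have hf : 0 < ECM.density p k := by
    refine hf0.lt_of_ne fun h => ?_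
    simp [ECM.sizeBiased, ← h] at hk
  have hk1 : 1 ≤ k := by
    refine Nat.one_le_iff_ne_zero.2 fun h => ?_
    simp [ECM.sizeBiased, h] at hk
  obtain ⟨s, a, b, hs, hsγ, ha, hδb, has, hb, hab, hab'⟩ :=
    ECM.exists_exponents hγ hδ hδ_lt hδ_lt'
  obtain ⟨C, hC⟩ := ECM.exists_card_bad_le p hk1 hf hν₁ hν₂ ha hδ hδb hab'
  have h1 := ECM.tendsto_pi_typicalSamples_compl p hs (hp.integrable_rpow hsγ) hf ha has hb hab
  -- The exponent is negative because `δ < b` and `a + 2 * b < 1`.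
  have h2 := ENNReal.tendsto_ofReal
    (ECM.tendsto_const_mul_natCast_rpow_zero C (by linarith : a + 2 * δ - 1 < 0))
  have h3 := h1.add h2
  rw [ENNReal.ofReal_zero, add_zero] at h3
  refine tendsto_of_tendsto_of_tendsto_of_le_of_le' tendsto_const_nhds h3
    (Filter.Eventually.of_forall fun n => zero_le) ?_
  filter_upwards [hC] with n hn
  refine ECM.erasedConfigurationModel_le p _ _ _ fun x hx => ?_
  convert hn x hx using 4
  ext m
  simp
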